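/- Let $M$ be a smooth manifold of dimension $n\ge 2$ with a smooth Riemannian metric $g_{ab}$ (a background metric in a given conformal class) and Levi-Civita connection $\nabla_a$. Let $\mathrm P_{ab}$ be the Schouten tensor $\mathrm P_{ab}=\frac1{n-2}\bigl(R_{ab}-\frac1{2(n-1)}Rg_{ab}\bigr)$ if $n\ge 3$; if $n=2$, let $\mathrm P_{ab}$ be a smooth symmetric tensor field (the Rho-tensor for $g_{ab}$ of a Möbius structure). Let $\gamma$ be a smooth oriented curve in $M$, given by a regular parametrisation on an open interval, with unit tangent vector $U^a$. Indices are raised and lowered with $g_{ab}$. Let $\partial=U^a\nabla_a$ on tensors along $\gamma$, put $A_a=\partial U_a$, and define the normalised jerk $$J_a=\partial A_a+(A^bA_b+\mathrm P_{bc}U^bU^c)U_a-\mathrm P_{ab}U^b .$$ In the presence of $g_{ab}$ the adjoint tractor bundle is $\mathcal A=\Lambda^1\oplus\Lambda^2\oplus\Lambda^0\oplus\Lambda^1$, with sections $(\sigma_b,\mu_{bc},\nu,\rho_b)$, and the adjoint tractor connection induces along $\gamma$ the derivative $$\partial\begin{pmatrix}\sigma_b\\ \mu_{bc}\\ \nu\\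 \rho_b\end{pmatrix}=\begin{pmatrix}\partial\sigma_b-U^a\mu_{ab}-\nu U_b\\ \partial\mu_{bc}-2U_{[b}\rho_{c]}+2U^a\mathrm P_{a[b}\sigma_{c]}\\ \partial\nu+U^a\rho_a+U^a\mathrm P_a{}^b\sigma_b\\ \partial\rho_b-U^a\mathrm P_a{}^c\mu_{bc}-U^a\mathrm P_{ab}\nu\end{pmatrix}.$$ Along $\gamma$ let $$\mathcal B=\mathrm{span}\bigl\{(0,0,0,U_b),\ (0,0,1,A_b),\ (U_b,\,2U_{[b}A_{c]},\,0,\,0)\bigr\},$$ $$\mathcal C=\bigl\{(0,F_{bc},0,F_{bc}A^c)\ :\ F_{bc}=-F_{cb},\ U^bF_{bc}=0\bigr\}.$$ Theorem. At every point of $\gamma$ one has $\mathcal B\cap\mathcal C=0$, and the subbundle $\mathcal S=\mathcal B\oplus\mathcal C\subset\mathcal A|_\gamma$ is preserved by $\partial$ (that is, $\partial$ maps smooth sections of $\mathcal S$ to sections of $\mathcal S$) if and only if $J_a\equiv 0$ along $\gamma$; equivalently, if and only if $\gamma$ is an unparameterised conformal circle, $\partial A_a=\mathrm P_{ab}U^b-(A^bA_b+\mathrm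 P_{bc}U^bU^c)U_a$. -/

import Mathlib

open Set Bundle
open scoped Manifold ContDiff

set_option maxSynthPendingDepth 3

noncomputable section

namespace AdjointTractor

/-! ### Local Riemannian geometry

In this section `G` is a Riemannian metric on an open set of a finite-dimensional vector space `E`:
`G y u v` is `g(u, v)` at `y`. -/

section Local

variable {E : Type*} [NormedAddCommGroup E] [NormedSpace ℝ E]

/-- Christoffel symbols of the first kind,
`K(u,v)_w = ½ (∂_u g(v,w) + ∂_v g(u,w) - ∂_w g(u,v))`. -/
def christoffelFirst (G : E → E →L[ℝ] E →L[ℝ] ℝ) (y : E) : E →L[ℝ] E →L[ℝ] E →L[ℝ] ℝ :=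
  (1 / 2 : ℝ) • (fderiv ℝ G y + (fderiv ℝ G y).flip -
    ((ContinuousLinearMap.flipₗᵢ ℝ E E ℝ :
      (E →L[ℝ] E →L[ℝ] ℝ) →L[ℝ] (E →L[ℝ] E →L[ℝ] ℝ))).comp (fderiv ℝ G y).flip)

theorem christoffelFirst_apply (G : E → E →L[ℝ] E →L[ℝ] ℝ) (y u v w : E) :
    christoffelFirst G y u v w =
      1 / 2 * (fderiv ℝ G y u v w + fderiv ℝ G y v u w - fderiv ℝ G y w u v) := by
  simp [christoffelFirst]

/-- Christoffel symbols `Γ(u,v)^k = g^{kl} K(u,v)_l` of the Levi-Civita connection. -/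
def christoffel (G : E → E →L[ℝ] E →L[ℝ] ℝ) (y : E) : E →L[ℝ] E →L[ℝ] E :=
  (ContinuousLinearMap.compL ℝ E (E →L[ℝ] ℝ) E (G y).inverse).comp (christoffelFirst G y)

theorem christoffel_apply (G : E → E →L[ℝ] E →L[ℝ] ℝ) (y u v : E) :
    christoffel G y u v = (G y).inverse (christoffelFirst G y u v) := by
  simp [christoffel]

/-- The curvature `R(u,v)w = ∂_u Γ(v,w) - ∂_v Γ(u,w) + Γ(u,Γ(v,w)) - Γ(v,Γ(u,w))`, as a bilinear
map in `v` and `w`. -/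
def riemann (G : E → E →L[ℝ] E →L[ℝ] ℝ) (y u : E) : E →L[ℝ] E →L[ℝ] E :=
  fderiv ℝ (christoffel G) y u - (fderiv ℝ (christoffel G) y).flip u
    + (ContinuousLinearMap.compL ℝ E E E (christoffel G y u)).comp (christoffel G y)
    - ((ContinuousLinearMap.compL ℝ E E E).flip (christoffel G y u)).comp (christoffel G y)

theorem riemann_apply (G : E → E →L[ℝ] E →L[ℝ] ℝ) (y u v w : E) :
    riemann G y u v w =
      fderiv ℝ (christoffel G) y u v w - fderiv ℝ (christoffel G) y v u w
        + christoffel G y u (christoffel G y v w)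
        - christoffel G y v (christoffel G y u w) := by
  simp [riemann]

/-- The trace of a linear map `u ↦ T u` with values in the bilinear maps from `E` to `E`, that is
the bilinear form whose value at `v, w` is the trace of `u ↦ T u v w`; here `b` is a basis with
continuous coordinates. -/
def traceBilin {ι : Type*} [Fintype ι] (b : ι → E) (c : ι → E →L[ℝ] ℝ)
    (T : E → E →L[ℝ] E →L[ℝ] E) : E →L[ℝ] E →L[ℝ] ℝ :=
  ∑ i, (ContinuousLinearMap.compL ℝ E E ℝ (c i)).comp (T (b i))

theorem traceBilin_apply {ι : Type*} [Fintype ι] (b : ι → E) (c : ι → E →L[ℝ] ℝ)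
    (T : E → E →L[ℝ] E →L[ℝ] E) (v w : E) :
    traceBilin b c T v w = ∑ i, c i (T (b i) v w) := by
  simp [traceBilin]

/-- The bilinear form `2 α_{[b} β_{c]} = α_b β_c - β_b α_c`. -/
def wedgeForm (α β : E →L[ℝ] ℝ) : E →L[ℝ] E →L[ℝ] ℝ :=
  α.smulRight β - β.smulRight α

theorem wedgeForm_apply (α β : E →L[ℝ] ℝ) (v w : E) :
    wedgeForm α β v w = α v * β w - β v * α w := by
  simp [wedgeForm]

variable (E) in
/-- 2-forms: the bilinear forms `μ` that are skew. -/
def skewForms : Submodule ℝ (E →L[ℝ] E →L[ℝ] ℝ) where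
  carrier := {μ | ∀ v, μ v v = 0}
  add_mem' := by
    intro a b ha hb v
    have h1 := ha v
    have h2 := hb v
    simp [h1, h2]
  zero_mem' := by intro v; simp
  smul_mem' := by
    intro c a ha v
    have h1 := ha v
    simp [h1]

theorem skewForms_swap {μ : E →L[ℝ] E →L[ℝ] ℝ} (h : μ ∈ skewForms E) (v w : E) :
    μ v w = -μ w v := by
  have h1 : μ (v + w) (v + w) = 0 := h (v + w)
  have h2 : μ v v = 0 := h v
  have h3 : μ w w = 0 := h w
  simp only [map_add, add_apply, h2, h3] at h1
  linarith

theorem deriv_mem_skewForms {f : ℝ → E →L[ℝ] E →L[ℝ] ℝ} (h : ∀ r, f r ∈ skewForms E) (t : ℝ) :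
    deriv f t ∈ skewForms E := by
  intro v
  by_cases hdiff : DifferentiableAt ℝ f t
  · have h1 := (hdiff.hasDerivAt.clm_apply (hasDerivAt_const t v)).clm_apply
      (hasDerivAt_const t v)
    have h2 : (fun r => f r v v) = fun _ => (0 : ℝ) := funext fun r => h r v
    rw [h2] at h1
    have h3 := h1.unique (hasDerivAt_const t (0 : ℝ))
    simpa using h3
  · rw [deriv_zero_of_not_differentiableAt hdiff]
    rfl

/-- The covariant derivative in the direction of a unit vector `U`, given the components
`f r` of a covector field in a fixed chart, `a = 1 / speed`, the value `α` at `t`, and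
`Γ_U = Γ(U, ·)`: the result is `a f'(t) - α ∘ Γ_U`. -/
def covDerivCovector (a : ℝ) (Γ_U : E →L[ℝ] E) (f : ℝ → E →L[ℝ] ℝ) (α : E →L[ℝ] ℝ) (t : ℝ) :
    E →L[ℝ] ℝ :=
  a • deriv f t - α.comp Γ_U

/-- The same for covariant 2-tensors: `a f'(t) - μ(Γ_U ·, ·) - μ(·, Γ_U ·)`. -/
def covDerivBilin (a : ℝ) (Γ_U : E →L[ℝ] E) (f : ℝ → E →L[ℝ] E →L[ℝ] ℝ)
    (μ : E →L[ℝ] E →L[ℝ] ℝ) (t : ℝ) : E →L[ℝ] E →L[ℝ] ℝ :=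
  a • deriv f t - μ.bilinearComp Γ_U (ContinuousLinearMap.id ℝ E)
    - μ.bilinearComp (ContinuousLinearMap.id ℝ E) Γ_U

theorem covDerivBilin_mem (a : ℝ) (Γ_U : E →L[ℝ] E) {f : ℝ → E →L[ℝ] E →L[ℝ] ℝ}
    {μ : E →L[ℝ] E →L[ℝ] ℝ} (hf : ∀ r, f r ∈ skewForms E) (hμ : μ ∈ skewForms E) (t : ℝ) :
    covDerivBilin a Γ_U f μ t ∈ skewForms E := by
  intro v
  have h1 : deriv f t v v = 0 := deriv_mem_skewForms hf t v
  have h2 := skewForms_swap hμ (Γ_U v) v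
  simp [covDerivBilin, h1, h2]

end Local

/-! ### Tensors on a Riemannian manifold

The manifold `M` is modelled on `Coord n = ℝⁿ`. In Mathlib the tangent space
`TangentSpace (𝓡 n) x` is `Coord n` by definition, a tangent vector at `x` being represented by its
components in the preferred chart at `x`. Tensors at `x` are written in the same way, and
`tangentCoordChange (𝓡 n) x₀ x x` turns the components in the preferred chart at `x₀` of a tangent
vector at `x` into its components in the preferred chart at `x`. -/

/-- The model space of an `n`-dimensional manifold. -/
abbrev Coord (n : ℕ) := EuclideanSpace ℝ (Fin n)

/-- Covectors `α_a` at a point. -/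
abbrev Covector (n : ℕ) := Coord n →L[ℝ] ℝ

/-- Covariant 2-tensors at a point; `μ v w` is `μ_{ab} v^a w^b`. -/
abbrev Bilin (n : ℕ) := Coord n →L[ℝ] Coord n →L[ℝ] ℝ

/-- 2-forms at a point. -/
abbrev TwoForm (n : ℕ) := skewForms (Coord n)

/-- Smooth Riemannian metrics on the `n`-manifold `M`. -/
abbrev Metric (n : ℕ) (M : Type*) [TopologicalSpace M] [ChartedSpace (Coord n) M]
    [IsManifold (𝓡 n) ∞ M] :=
  ContMDiffRiemannianMetric (𝓡 n) ∞ (Coord n) (fun x : M => TangentSpace (𝓡 n) x)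

section Manifold

variable {n : ℕ} {M : Type*} [TopologicalSpace M] [ChartedSpace (Coord n) M]
  [IsManifold (𝓡 n) ∞ M]

/-- The components, in the preferred chart at `x₀`, of a covector `α` at `x`. -/
def covectorInChart (x₀ x : M) (α : Covector n) : Covector n :=
  α.comp (tangentCoordChange (𝓡 n) x₀ x x)

/-- The components, in the preferred chart at `x₀`, of a covariant 2-tensor `μ` at `x`. -/
def bilinInChart (x₀ x : M) (μ : Bilin n) : Bilin n :=
  μ.bilinearComp (tangentCoordChange (𝓡 n) x₀ x x) (tangentCoordChange (𝓡 n) x₀ x x)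

theorem bilinInChart_mem (x₀ x : M) {μ : Bilin n} (hμ : μ ∈ TwoForm n) :
    bilinInChart x₀ x μ ∈ TwoForm n :=
  fun v => hμ (tangentCoordChange (𝓡 n) x₀ x x v)

/-- The field of covariant 2-tensors `P` on `M` is smooth. -/
def IsSmoothBilinField (P : M → Bilin n) : Prop :=
  ∀ x₀ : M, ContDiffOn ℝ ∞
    (fun y => bilinInChart x₀ ((extChartAt (𝓡 n) x₀).symm y) (P ((extChartAt (𝓡 n) x₀).symm y)))
    (extChartAt (𝓡 n) x₀).target

/-- The metric `g_{ab}` at `x`. -/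
def metricAt (g : Metric n M) (x : M) : Bilin n := g.inner x

/-- The components `g_{ij}` at the coordinates `y`, in the preferred chart at `x₀`. -/
def metricInChart (g : Metric n M) (x₀ : M) (y : Coord n) : Bilin n :=
  bilinInChart x₀ ((extChartAt (𝓡 n) x₀).symm y) (metricAt g ((extChartAt (𝓡 n) x₀).symm y))

/-- The isomorphism from covectors to vectors at `x` that raises an index with `g`. -/
def sharp (g : Metric n M) (x : M) : Covector n →L[ℝ] Coord n := (metricAt g x).inverse

/-- The Ricci tensor at `x`: `Ric(v,w)` is the trace of `u ↦ R(u,v)w`. -/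
def ricci (g : Metric n M) (x : M) : Bilin n :=
  traceBilin (fun i : Fin n => EuclideanSpace.single i (1 : ℝ)) (fun i => EuclideanSpace.proj i)
    (riemann (metricInChart g x) (extChartAt (𝓡 n) x x))

/-- The scalar curvature `g^{ab} R_{ab}`. -/
def scalarCurvature (g : Metric n M) (x : M) : ℝ :=
  ∑ i : Fin n, sharp g x (ricci g x (EuclideanSpace.single i (1 : ℝ))) i

/-- The Schouten tensor `P_{ab} = (R_{ab} - R g_{ab} / (2(n-1))) / (n-2)`, for `n ≥ 3`. -/
def schouten (g : Metric n M) (x : M) : Bilin n :=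
  (1 / ((n : ℝ) - 2)) •
    (ricci g x - (scalarCurvature g x / (2 * ((n : ℝ) - 1))) • metricAt g x)

/-- `P` is the Rho-tensor that belongs to the background metric `g`: the Schouten tensor of `g` if
`n ≥ 3`, and, if `n = 2`, any smooth symmetric tensor field (it is then the value at `g` of a
Möbius structure on the conformal class of `g`). -/
def IsRhoTensor (g : Metric n M) (P : M → Bilin n) : Prop :=
  (3 ≤ n ∧ P = schouten g) ∨
  (n = 2 ∧ IsSmoothBilinField P ∧ ∀ x v w, P x v w = P x w v)

/-! ### Curves and the directional derivative `∂ = U^a ∇_a` -/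


/-- The velocity `γ'(t)` of a parametrisation. -/
def velocity (n : ℕ) {M : Type*} [TopologicalSpace M] [ChartedSpace (Coord n) M]
    (γ : ℝ → M) (t : ℝ) : Coord n :=
  mfderiv 𝓘(ℝ, ℝ) (𝓡 n) γ t (1 : ℝ)

/-- `γ` restricted to `s` is a regular parametrisation of a smooth oriented curve, `s` being an
open interval. -/
structure IsRegularCurve (n : ℕ) {M : Type*} [TopologicalSpace M] [ChartedSpace (Coord n) M]
    (γ : ℝ → M) (s : Set ℝ) : Prop where
  isOpen : IsOpen s
  ordConnected : s.OrdConnected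
  contMDiffOn : ContMDiffOn 𝓘(ℝ, ℝ) (𝓡 n) ∞ γ s
  velocity_ne_zero : ∀ t ∈ s, velocity n γ t ≠ 0

/-- The speed of a parametrisation. -/
def speed (g : Metric n M) (γ : ℝ → M) (t : ℝ) : ℝ :=
  √(metricAt g (γ t) (velocity n γ t) (velocity n γ t))

/-- The unit tangent vector `U^a`. -/
def unitTangent (g : Metric n M) (γ : ℝ → M) (t : ℝ) : Coord n :=
  (speed g γ t)⁻¹ • velocity n γ t

/-- `U_a = g_{ab} U^b`. -/
def unitCovector (g : Metric n M) (γ : ℝ → M) (t : ℝ) : Covector n :=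
  metricAt g (γ t) (unitTangent g γ t)

/-- The endomorphism `w ↦ Γ(U, w)` in the preferred chart at `γ t`. -/
def connectionAlong (g : Metric n M) (γ : ℝ → M) (t : ℝ) : Coord n →L[ℝ] Coord n :=
  christoffel (metricInChart g (γ t)) (extChartAt (𝓡 n) (γ t) (γ t)) (unitTangent g γ t)

/-- `∂f = U^a ∇_a f` for functions along the curve. -/
def partialFun (g : Metric n M) (γ : ℝ → M) (f : ℝ → ℝ) (t : ℝ) : ℝ :=
  (speed g γ t)⁻¹ * deriv f t

/-- `∂α_b = U^a ∇_a α_b` for 1-forms along the curve (`α r` is a covector at `γ r`): in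
coordinates, `U^a ∂_a α_b - Γ_{ab}^c U^a α_c`. -/
def partialCovector (g : Metric n M) (γ : ℝ → M) (α : ℝ → Covector n) (t : ℝ) : Covector n :=
  covDerivCovector (speed g γ t)⁻¹ (connectionAlong g γ t)
    (fun r => covectorInChart (γ t) (γ r) (α r)) (α t) t

/-- `∂μ_{bc} = U^a ∇_a μ_{bc}` for 2-forms along the curve: in coordinates,
`U^a ∂_a μ_{bc} - Γ_{ab}^d U^a μ_{dc} - Γ_{ac}^d U^a μ_{bd}`. -/
def partialTwoForm (g : Metric n M) (γ : ℝ → M) (μ : ℝ → TwoForm n) (t : ℝ) : TwoForm n :=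
  ⟨covDerivBilin (speed g γ t)⁻¹ (connectionAlong g γ t)
      (fun r => bilinInChart (γ t) (γ r) (μ r)) (μ t) t,
    covDerivBilin_mem _ _ (fun r => bilinInChart_mem _ _ (μ r).2) (μ t).2 t⟩

/-- The acceleration `A_a = ∂ U_a`. -/
def acceleration (g : Metric n M) (γ : ℝ → M) (t : ℝ) : Covector n :=
  partialCovector g γ (unitCovector g γ) t

/-- `A^a = g^{ab} A_b`. -/
def accelerationVector (g : Metric n M) (γ : ℝ → M) (t : ℝ) : Coord n :=
  sharp g (γ t) (acceleration g γ t)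

/-- The normalised jerk `J_a = ∂A_a + (A^b A_b + P_{bc} U^b U^c) U_a - P_{ab} U^b`. -/
def normalisedJerk (g : Metric n M) (P : M → Bilin n) (γ : ℝ → M) (t : ℝ) : Covector n :=
  partialCovector g γ (acceleration g γ) t
    + (acceleration g γ t (accelerationVector g γ t)
        + P (γ t) (unitTangent g γ t) (unitTangent g γ t)) • unitCovector g γ t
    - (P (γ t)).flip (unitTangent g γ t)

/-- The equation `∂A_a = P_{ab} U^b - (A^b A_b + P_{bc} U^b U^c) U_a` of unparameterised
conformal circles. -/
def IsConformalCircle (g : Metric n M) (P : M → Bilin n) (γ : ℝ → M) (s : Set ℝ) : Prop :=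
  ∀ t ∈ s, partialCovector g γ (acceleration g γ) t =
    (P (γ t)).flip (unitTangent g γ t)
      - (acceleration g γ t (accelerationVector g γ t)
          + P (γ t) (unitTangent g γ t) (unitTangent g γ t)) • unitCovector g γ t

/-! ### Adjoint tractors along the curve -/

/-- The fibre of the adjoint tractor bundle at a point, in the splitting given by a metric:
quadruples `(σ_b, μ_{bc}, ν, ρ_b)`. -/
abbrev Tractor (n : ℕ) := Covector n × TwoForm n × ℝ × Covector n

/-- The 2-form `2 α_{[b} β_{c]} = α_b β_c - β_b α_c`. -/
def wedge (α β : Covector n) : TwoForm n :=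
  ⟨wedgeForm α β, fun v => by rw [wedgeForm_apply]; ring⟩

/-- A section `Φ` of the tractor bundle along the curve (`Φ r` is in the fibre at `γ r`) is smooth
on `s`: its components in charts are smooth. -/
structure IsSmoothAlong (γ : ℝ → M) (s : Set ℝ) (Φ : ℝ → Tractor n) : Prop where
  sigma : ∀ t ∈ s, ContDiffAt ℝ ∞ (fun r => covectorInChart (γ t) (γ r) (Φ r).1) t
  mu : ∀ t ∈ s, ContDiffAt ℝ ∞ (fun r => bilinInChart (γ t) (γ r) ((Φ r).2.1 : Bilin n)) t
  nu : ∀ t ∈ s, ContDiffAt ℝ ∞ (fun r => (Φ r).2.2.1) t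
  rho : ∀ t ∈ s, ContDiffAt ℝ ∞ (fun r => covectorInChart (γ t) (γ r) (Φ r).2.2.2) t

/-- The directional derivative along the curve induced by the adjoint tractor connection:
* `σ`-slot: `∂σ_b - U^a μ_{ab} - ν U_b`,
* `μ`-slot: `∂μ_{bc} - 2 U_{[b} ρ_{c]} + 2 U^a P_{a[b} σ_{c]}`,
* `ν`-slot: `∂ν + U^a ρ_a + U^a P_a{}^b σ_b`,
* `ρ`-slot: `∂ρ_b - U^a P_a{}^c μ_{bc} - U^a P_{ab} ν`.
The last slot contracts `P` with the second index of `μ`. -/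
def tractorDerivative (g : Metric n M) (P : M → Bilin n) (γ : ℝ → M)
    (Φ : ℝ → Tractor n) (t : ℝ) : Tractor n :=
  let U : Coord n := unitTangent g γ t
  let UP : Covector n := P (γ t) U
  let σ : Covector n := (Φ t).1
  let μ : Bilin n := (Φ t).2.1
  let ν : ℝ := (Φ t).2.2.1
  let ρ : Covector n := (Φ t).2.2.2
  (partialCovector g γ (fun r => (Φ r).1) t - μ U - ν • unitCovector g γ t,
   partialTwoForm g γ (fun r => (Φ r).2.1) t - wedge (unitCovector g γ t) ρ + wedge UP σ,
   partialFun g γ (fun r => (Φ r).2.2.1) t + ρ U + σ (sharp g (γ t) UP),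
   partialCovector g γ (fun r => (Φ r).2.2.2) t - μ.flip (sharp g (γ t) UP) - ν • UP)

/-- The bundle `B`, spanned by `(0,0,0,U_b)`, `(0,0,1,A_b)` and `(U_b, 2U_{[b}A_{c]}, 0, 0)`. -/
def bundleB (g : Metric n M) (γ : ℝ → M) (t : ℝ) : Submodule ℝ (Tractor n) :=
  Submodule.span ℝ
    {(0, 0, 0, unitCovector g γ t),
     (0, 0, 1, acceleration g γ t),
     (unitCovector g γ t, wedge (unitCovector g γ t) (acceleration g γ t), 0, 0)}

/-- The bundle `C` of all `(0, F_{bc}, 0, F_{bc} A^c)` with `U^b F_{bc} = 0`. -/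
def bundleC (g : Metric n M) (γ : ℝ → M) (t : ℝ) : Submodule ℝ (Tractor n) where
  carrier := {z | ∃ F : TwoForm n, (F : Bilin n) (unitTangent g γ t) = 0 ∧
    z = (0, F, 0, (F : Bilin n).flip (accelerationVector g γ t))}
  add_mem' := by
    rintro _ _ ⟨F, hF, rfl⟩ ⟨F', hF', rfl⟩
    refine ⟨F + F', ?_, ?_⟩
    · rw [Submodule.coe_add, add_apply, hF, hF', add_zero]
    · simp only [Prod.mk_add_mk, add_zero, Submodule.coe_add, ContinuousLinearMap.flip_add,
        add_apply]
  zero_mem' := ⟨0, rfl, rfl⟩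
  smul_mem' := by
    rintro c _ ⟨F, hF, rfl⟩
    refine ⟨c • F, ?_, ?_⟩
    · rw [Submodule.coe_smul, smul_apply, hF, smul_zero]
    · simp only [Prod.smul_mk, smul_zero, Submodule.coe_smul, ContinuousLinearMap.flip_smul,
        smul_apply]

/-- The bundle `S = B + C` along the curve. -/
def bundleS (g : Metric n M) (γ : ℝ → M) (t : ℝ) : Submodule ℝ (Tractor n) :=
  bundleB g γ t ⊔ bundleC g γ t

/-- A family `V` of subspaces of the tractor fibres along the curve is preserved by `∂`:
`∂` maps smooth sections of `V` to sections of `V`. -/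
def IsPreserved (g : Metric n M) (P : M → Bilin n) (γ : ℝ → M) (s : Set ℝ)
    (V : ℝ → Submodule ℝ (Tractor n)) : Prop :=
  ∀ Φ : ℝ → Tractor n, IsSmoothAlong γ s Φ → (∀ t ∈ s, Φ t ∈ V t) →
    ∀ t ∈ s, tractorDerivative g P γ Φ t ∈ V t

end Manifold

end AdjointTractor

end

/-! The subbundle $\mathcal S$ is cut out by linear equations (`mem_bundleS_iff`):
$(\sigma,\mu,\nu,\rho)\in\mathcal S$ iff, for some $c,k$, $\sigma=cU$, $U^b\mu_{bc}=cA_c$ and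
$\rho_b=kU_b+\nu A_b+\mu_{bc}A^c$. The scalars are contractions, $c=\sigma(U)$ and
$k=\rho(U)-\mu(U,A)$, so they are smooth for a smooth section and the equations can be
differentiated along $\gamma$.

By the Leibniz rule, $\partial U=A$ and $\nabla g=0$, the tractor derivative of a section of
$\mathcal S$ satisfies the same equations, with new $c$ and $k$, up to an error $cJ$ in the second
equation and $\nu J_b+\mu_{bc}J^c$ in the third, modulo $U$. Hence $J=0$ suffices
(`isPreserved_of_normalisedJerk`). Conversely, the section $(0,0,1,A)$ has $c=0$, $\mu=0$, $\nu=1$,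
so invariance makes $J$ a multiple of $U$; since $U$ is a unit vector, $J(U)=0$ always, and $J=0$
(`normalisedJerk_eq_zero`).

Two points need real work. The connection contracts $\mathrm P$ on the other side from $J$, so
$\mathrm P$ must be symmetric; for the Schouten tensor this is the symmetry of Ricci, which comes
from the Bianchi identity and the skewness of curvature (`traceBilin_riemann_comm`). And $A$ at each
point is computed in the preferred chart of that point, while differentiating it requires a single
chart; the covariance of $A$ is obtained by recognising it as an Euler-Lagrange expression
(`eulerLagrange_pullback`, `acceleration_inChart`). -/

namespace AdjointTractor

open Filter Topology

/-! ### Levi-Civita connection of a local metric: compatibility, curvature symmetries, symmetry of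
Ricci. -/

section LocalMetric

variable {E : Type*} [NormedAddCommGroup E] [NormedSpace ℝ E]

/-- `G` is smooth at `y`, and symmetric and nondegenerate near `y`. -/
structure IsMetricNear (G : E → E →L[ℝ] E →L[ℝ] ℝ) (y : E) : Prop where
  contDiffAt : ContDiffAt ℝ ∞ G y
  symm : ∀ᶠ z in 𝓝 y, ∀ u v, G z u v = G z v u
  invertible : ∀ᶠ z in 𝓝 y, (G z).IsInvertible

namespace IsMetricNear

variable {G : E → E →L[ℝ] E →L[ℝ] ℝ} {y : E}

/-- Smoothness of order `∞` at a point need not spread to one neighbourhood, but each finite order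
does. Nearby, only differentiability is needed, so order 3 is ample. -/
theorem eventually (h : IsMetricNear G y) : ∀ᶠ z in 𝓝 y, ContDiffAt ℝ 3 G z ∧
    (∀ᶠ z' in 𝓝 z, ∀ u v, G z' u v = G z' v u) ∧ (G z).IsInvertible := by
  have h3 : ContDiffAt ℝ 3 G y := h.contDiffAt.of_le ENat.LEInfty.out
  exact (h3.eventually (by simp)).and (h.symm.eventually_nhds.and h.invertible)

theorem fderiv_symm_of_eventually (hd : DifferentiableAt ℝ G y)
    (hs : ∀ᶠ z in 𝓝 y, ∀ u v, G z u v = G z v u) (w u v : E) :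
    fderiv ℝ G y w u v = fderiv ℝ G y w v u := by
  have h1 (a b : E) : HasFDerivAt (fun z => G z a b)
      ((((fderiv ℝ G y).flip a).flip b)) y := by
    have := (hd.hasFDerivAt.clm_apply (hasFDerivAt_const a y)).clm_apply (hasFDerivAt_const b y)
    refine this.congr_fderiv ?_
    ext; simp
  have h2 : (fun z => G z u v) =ᶠ[𝓝 y] fun z => G z v u := by
    filter_upwards [hs] with z hz using hz u v
  have h3 := (h1 u v).unique ((h1 v u).congr_of_eventuallyEq h2)
  simpa using congrArg (fun L : E →L[ℝ] ℝ => L w) h3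

theorem christoffelFirst_comm (hd : DifferentiableAt ℝ G y)
    (hs : ∀ᶠ z in 𝓝 y, ∀ u v, G z u v = G z v u) (u v w : E) :
    christoffelFirst G y u v w = christoffelFirst G y v u w := by
  rw [christoffelFirst_apply, christoffelFirst_apply, fderiv_symm_of_eventually hd hs w u v]
  ring

theorem christoffel_comm_of_eventually (hd : DifferentiableAt ℝ G y)
    (hs : ∀ᶠ z in 𝓝 y, ∀ u v, G z u v = G z v u) (u v : E) :
    christoffel G y u v = christoffel G y v u := by
  rw [christoffel_apply, christoffel_apply]
  congr 1
  ext w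
  exact christoffelFirst_comm hd hs u v w

theorem apply_christoffel (hi : (G y).IsInvertible) (u v w : E) :
    G y (christoffel G y u v) w = christoffelFirst G y u v w := by
  rw [christoffel_apply, hi.self_apply_inverse]

/-- This is $\nabla g=0$: once the index is lowered, both terms on the right are Christoffel symbols
of the first kind, and in their sum all derivatives of the metric but one cancel. -/
theorem compat_of_eventually (hd : DifferentiableAt ℝ G y)
    (hs : ∀ᶠ z in 𝓝 y, ∀ u v, G z u v = G z v u) (hi : (G y).IsInvertible) (u v w : E) :
    fderiv ℝ G y u v w = G y (christoffel G y u v) w + G y v (christoffel G y u w) := by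
  rw [hs.self_of_nhds v, apply_christoffel hi, apply_christoffel hi, christoffelFirst_apply,
    christoffelFirst_apply, fderiv_symm_of_eventually hd hs u w v]
  ring

theorem differentiableAt (h : IsMetricNear G y) : DifferentiableAt ℝ G y :=
  h.contDiffAt.differentiableAt (by simp)

theorem compat (h : IsMetricNear G y) (u v w : E) :
    fderiv ℝ G y u v w = G y (christoffel G y u v) w + G y v (christoffel G y u w) :=
  compat_of_eventually h.differentiableAt h.symm h.invertible.self_of_nhds u v w

theorem eventually_compat (h : IsMetricNear G y) : ∀ᶠ z in 𝓝 y, ∀ u v w,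
    fderiv ℝ G z u v w = G z (christoffel G z u v) w + G z v (christoffel G z u w) := by
  filter_upwards [h.eventually] with z ⟨h1, h2, h3⟩
  exact compat_of_eventually (h1.differentiableAt (by norm_num)) h2 h3

theorem eventually_christoffel_comm (h : IsMetricNear G y) : ∀ᶠ z in 𝓝 y, ∀ u v,
    christoffel G z u v = christoffel G z v u := by
  filter_upwards [h.eventually] with z ⟨h1, h2, _⟩
  exact christoffel_comm_of_eventually (h1.differentiableAt (by norm_num)) h2

theorem contDiffAt_fderiv (h : IsMetricNear G y) : ContDiffAt ℝ ∞ (fderiv ℝ G) y :=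
  h.contDiffAt.fderiv_right (by simp)

theorem differentiableAt_fderiv (h : IsMetricNear G y) : DifferentiableAt ℝ (fderiv ℝ G) y :=
  h.contDiffAt_fderiv.differentiableAt (by simp)

theorem riemann_swap (u v w : E) : riemann G y u v w = -riemann G y v u w := by
  simp only [riemann_apply]
  abel

variable [CompleteSpace E]

theorem contDiffAt_inverse (h : IsMetricNear G y) :
    ContDiffAt ℝ ∞ (fun z => (G z).inverse) y :=
  (h.invertible.self_of_nhds.contDiffAt_map_inverse (n := ∞)).comp y h.contDiffAt

theorem differentiableAt_christoffel (h : IsMetricNear G y) :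
    DifferentiableAt ℝ (christoffel G) y := by
  have h1 : ContDiffAt ℝ ∞ (christoffelFirst G) y := by
    have hflip : ContDiffAt ℝ ∞ (fun z => (fderiv ℝ G z).flip) y :=
      ((ContinuousLinearMap.flipₗᵢ ℝ E E (E →L[ℝ] ℝ) :
        (E →L[ℝ] E →L[ℝ] E →L[ℝ] ℝ) →L[ℝ] (E →L[ℝ] E →L[ℝ] E →L[ℝ] ℝ)).contDiff).contDiffAt.comp y
        h.contDiffAt_fderiv
    exact (contDiffAt_const (c := (1 / 2 : ℝ))).smul ((h.contDiffAt_fderiv.add hflip).sub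
      (contDiffAt_const.clm_comp hflip))
  have h2 : ContDiffAt ℝ ∞ (christoffel G) y :=
    (((ContinuousLinearMap.compL ℝ E (E →L[ℝ] ℝ) E).contDiff).contDiffAt.comp y
      h.contDiffAt_inverse).clm_comp h1
  exact h2.differentiableAt (by simp)

theorem hasFDerivAt_christoffel_apply (h : IsMetricNear G y) (u v : E) :
    HasFDerivAt (fun z => christoffel G z u v)
      (((fderiv ℝ (christoffel G) y).flip u).flip v) y := by
  have := (h.differentiableAt_christoffel.hasFDerivAt.clm_apply
    (hasFDerivAt_const u y)).clm_apply (hasFDerivAt_const v y)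
  refine this.congr_fderiv ?_
  ext; simp

theorem fderiv_christoffel_comm (h : IsMetricNear G y) (w u v : E) :
    fderiv ℝ (christoffel G) y w u v = fderiv ℝ (christoffel G) y w v u := by
  have h2 : (fun z => christoffel G z u v) =ᶠ[𝓝 y] fun z => christoffel G z v u := by
    filter_upwards [h.eventually_christoffel_comm] with z hz using hz u v
  have h3 := (h.hasFDerivAt_christoffel_apply u v).unique
    ((h.hasFDerivAt_christoffel_apply v u).congr_of_eventuallyEq h2)
  simpa using congrArg (fun L : E →L[ℝ] E => L w) h3

/-- The first Bianchi identity. -/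
theorem riemann_cyclic (h : IsMetricNear G y) (u v w : E) :
    riemann G y u v w + riemann G y v w u + riemann G y w u v = 0 := by
  have hc := h.eventually_christoffel_comm.self_of_nhds
  simp only [riemann_apply]
  rw [h.fderiv_christoffel_comm u w v, h.fderiv_christoffel_comm v w u,
    h.fderiv_christoffel_comm w v u, hc w v, hc w u, hc v u]
  abel

/-- The second derivative of a metric in terms of its Christoffel symbols. -/
theorem fderiv_fderiv_apply (h : IsMetricNear G y) (w v a b : E) :
    fderiv ℝ (fderiv ℝ G) y w v a b =
      fderiv ℝ G y w (christoffel G y v a) b + G y (fderiv ℝ (christoffel G) y w v a) b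
      + (fderiv ℝ G y w a (christoffel G y v b) + G y a (fderiv ℝ (christoffel G) y w v b)) := by
  have hl := ((h.differentiableAt_fderiv.hasFDerivAt.clm_apply
    (hasFDerivAt_const v y)).clm_apply (hasFDerivAt_const a y)).clm_apply (hasFDerivAt_const b y)
  have hG := h.differentiableAt.hasFDerivAt
  have h1 := (hG.clm_apply (h.hasFDerivAt_christoffel_apply v a)).clm_apply (hasFDerivAt_const b y)
  have h2 := (hG.clm_apply (hasFDerivAt_const a y)).clm_apply (h.hasFDerivAt_christoffel_apply v b)
  have he : (fun z => fderiv ℝ G z v a b) =ᶠ[𝓝 y]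
      ((fun z => G z (christoffel G z v a) b) + fun z => G z a (christoffel G z v b)) := by
    filter_upwards [h.eventually_compat] with z hz using hz v a b
  have h3 := congrArg (fun L : E →L[ℝ] ℝ => L w)
    (hl.unique ((h1.add h2).congr_of_eventuallyEq he))
  simp at h3
  linarith

/-- The curvature endomorphisms of a Levi-Civita connection are skew. -/
theorem riemann_skew (h : IsMetricNear G y) (w v a b : E) :
    G y (riemann G y w v a) b = -G y a (riemann G y w v b) := by
  have h1 := h.fderiv_fderiv_apply w v a b
  have h2 := h.fderiv_fderiv_apply v w a b
  have hsym : IsSymmSndFDerivAt ℝ G y :=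
    h.contDiffAt.isSymmSndFDerivAt (by simpa using ENat.LEInfty.out)
  -- Equality of mixed partials equates the two expansions. With `compat` inserted, the cross terms
  -- $G(\Gamma_v a,\Gamma_w b)+G(\Gamma_w a,\Gamma_v b)$ are symmetric in $v,w$ and drop out,
  -- leaving exactly the two curvature terms.
  have h3 : fderiv ℝ (fderiv ℝ G) y w v a b = fderiv ℝ (fderiv ℝ G) y v w a b := by
    rw [hsym.eq w v]
  simp only [h.compat w, h.compat v] at h1 h2
  simp only [riemann_apply, map_add, map_sub, add_apply, sub_apply]
  linarith

end IsMetricNear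

/-- An endomorphism that is skew for a nondegenerate symmetric bilinear form has trace zero. -/
theorem trace_eq_zero_of_skew [FiniteDimensional ℝ E] {B : E →L[ℝ] E →L[ℝ] ℝ}
    (hB : B.IsInvertible) {L : E →ₗ[ℝ] E}
    (hL : ∀ a b, B (L a) b = -B a (L b)) : LinearMap.trace ℝ E L = 0 := by
  let e : E ≃ₗ[ℝ] Module.Dual ℝ E :=
    LinearEquiv.ofBijective
      ((LinearMap.toContinuousLinearMap (𝕜 := ℝ) (E := E) (F' := ℝ)).symm.toLinearMap ∘ₗ
        (B : E →ₗ[ℝ] E →L[ℝ] ℝ))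
      ((LinearMap.toContinuousLinearMap (𝕜 := ℝ) (E := E) (F' := ℝ)).symm.bijective.comp
        hB.bijective)
  have he (a b : E) : e a b = B a b := rfl
  -- Skewness says that the form intertwines `L` with minus its transpose, so the trace equals its
  -- own negative.
  have h1 : e.conj L = -Module.Dual.transpose (R := ℝ) L := by
    ext f b
    obtain ⟨a, rfl⟩ := e.surjective f
    simp [LinearEquiv.conj_apply, he, hL, Module.Dual.transpose]
  have h2 := LinearMap.trace_conj' L e
  rw [h1, map_neg, LinearMap.trace_transpose'] at h2
  linarith

end LocalMetric

/-- Symmetry of Ricci: by the Bianchi identity its antisymmetric part is, up to sign, the trace of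
the endomorphism $R(v,w)$, which is skew for the metric and hence traceless. -/
theorem traceBilin_riemann_comm {n : ℕ} {G : Coord n → Bilin n} {y : Coord n}
    (h : IsMetricNear G y) (v w : Coord n) :
    traceBilin (fun i : Fin n => EuclideanSpace.single i (1 : ℝ))
        (fun i => EuclideanSpace.proj i) (riemann G y) v w =
      traceBilin (fun i : Fin n => EuclideanSpace.single i (1 : ℝ))
        (fun i => EuclideanSpace.proj i) (riemann G y) w v := by
  have h1 := trace_eq_zero_of_skew (L := (riemann G y v w : Coord n →ₗ[ℝ] Coord n))
    h.invertible.self_of_nhds (h.riemann_skew v w)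
  rw [LinearMap.trace_eq_matrix_trace ℝ (EuclideanSpace.basisFun (Fin n) ℝ).toBasis] at h1
  simp only [Matrix.trace, Matrix.diag, LinearMap.toMatrix_apply, OrthonormalBasis.coe_toBasis,
    OrthonormalBasis.coe_toBasis_repr_apply, EuclideanSpace.basisFun_apply,
    EuclideanSpace.basisFun_repr] at h1
  rw [← sub_eq_zero, traceBilin_apply, traceBilin_apply, ← Finset.sum_sub_distrib, ← neg_eq_zero,
    ← h1, ← Finset.sum_neg_distrib]
  refine Finset.sum_congr rfl fun i _ => ?_
  rw [← map_sub, ← map_neg]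
  have h2 := h.riemann_cyclic (EuclideanSpace.single i 1) v w
  have h3 := IsMetricNear.riemann_swap (G := G) (y := y) w (EuclideanSpace.single i 1) v
  rw [h3] at h2
  have h4 : -(riemann G y (EuclideanSpace.single i 1) v w
      - riemann G y (EuclideanSpace.single i 1) w v) = riemann G y v w (EuclideanSpace.single i 1) := by
    rw [← sub_eq_zero, ← neg_eq_zero, ← h2]; abel
  rw [h4]
  rfl

/-! ### Components in charts, the metric in charts, symmetry of the Rho-tensor. -/

section Manifold

variable {n : ℕ} {M : Type*} [TopologicalSpace M] [ChartedSpace (Coord n) M]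
  [IsManifold (𝓡 n) ∞ M]

/-- The vector at `z` with given components in the preferred chart at `x`. -/
noncomputable def fromChart (x z : M) : Coord n →L[ℝ] Coord n := tangentCoordChange (𝓡 n) x z z

/-- The components, in the preferred chart at `x`, of a tangent vector at `z`. -/
noncomputable def toChart (x z : M) : Coord n →L[ℝ] Coord n := tangentCoordChange (𝓡 n) z x z

theorem covectorInChart_apply (x z : M) (α : Covector n) (v : Coord n) :
    covectorInChart x z α v = α (fromChart x z v) :=
  rfl

theorem bilinInChart_apply (x z : M) (μ : Bilin n) (v w : Coord n) :
    bilinInChart x z μ v w = μ (fromChart x z v) (fromChart x z w) :=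
  rfl

theorem fromChart_toChart {x z : M} (hz : z ∈ (extChartAt (𝓡 n) x).source) (v : Coord n) :
    fromChart x z (toChart x z v) = v := by
  rw [fromChart, toChart,
    tangentCoordChange_comp ⟨⟨mem_extChartAt_source z, hz⟩, mem_extChartAt_source z⟩,
    tangentCoordChange_self (mem_extChartAt_source z)]

theorem toChart_fromChart {x z : M} (hz : z ∈ (extChartAt (𝓡 n) x).source) (v : Coord n) :
    toChart x z (fromChart x z v) = v := by
  rw [fromChart, toChart, tangentCoordChange_comp ⟨⟨hz, mem_extChartAt_source z⟩, hz⟩,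
    tangentCoordChange_self hz]

theorem fromChart_self (x : M) (v : Coord n) : fromChart x x v = v :=
  tangentCoordChange_self (mem_extChartAt_source x)

theorem toChart_self (x : M) (v : Coord n) : toChart x x v = v :=
  tangentCoordChange_self (mem_extChartAt_source x)

theorem metricAt_comm (g : Metric n M) (x : M) (v w : Coord n) :
    metricAt g x v w = metricAt g x w v :=
  g.symm x v w

theorem metricAt_pos (g : Metric n M) (x : M) {v : Coord n} (hv : v ≠ 0) :
    0 < metricAt g x v v :=
  g.pos x v hv

theorem isInvertible_of_pos {B : Bilin n} (hB : ∀ v, v ≠ 0 → 0 < B v v) : B.IsInvertible := by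
  have hinj : Function.Injective (B : Coord n →ₗ[ℝ] Covector n) := by
    rw [← LinearMap.ker_eq_bot, LinearMap.ker_eq_bot']
    intro v hv
    by_contra hne
    have h1 : B v = 0 := hv
    have := hB v hne
    simp [h1] at this
  have hrank : Module.finrank ℝ (Coord n) = Module.finrank ℝ (Covector n) := by
    rw [← (LinearMap.toContinuousLinearMap (𝕜 := ℝ) (E := Coord n) (F' := ℝ)).finrank_eq,
      Module.finrank_linearMap, Module.finrank_self, mul_one]
  refine ⟨(LinearEquiv.ofInjectiveOfFinrankEq _ hinj hrank).toContinuousLinearEquiv, ?_⟩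
  ext; rfl

theorem metricAt_isInvertible (g : Metric n M) (x : M) : (metricAt g x).IsInvertible :=
  isInvertible_of_pos fun _ hv => metricAt_pos g x hv

theorem metricInChart_extChartAt (g : Metric n M) {x z : M}
    (hz : z ∈ (extChartAt (𝓡 n) x).source) :
    metricInChart g x (extChartAt (𝓡 n) x z) = bilinInChart x z (metricAt g z) := by
  rw [metricInChart, (extChartAt (𝓡 n) x).left_inv hz]

theorem bilinInChart_self (x : M) (μ : Bilin n) : bilinInChart x x μ = μ := by
  ext v w
  rw [bilinInChart_apply, fromChart_self, fromChart_self]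

theorem covectorInChart_self (x : M) (α : Covector n) : covectorInChart x x α = α := by
  ext v
  rw [covectorInChart_apply, fromChart_self]

theorem metricInChart_self (g : Metric n M) (x : M) :
    metricInChart g x (extChartAt (𝓡 n) x x) = metricAt g x := by
  rw [metricInChart_extChartAt g (mem_extChartAt_source x), bilinInChart_self]

theorem bilinInChart_pos {x z : M} (hz : z ∈ (extChartAt (𝓡 n) x).source) {B : Bilin n}
    (hB : ∀ v, v ≠ 0 → 0 < B v v) (v : Coord n) (hv : v ≠ 0) : 0 < bilinInChart x z B v v := by
  refine hB _ fun h0 => hv ?_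
  have h1 : fromChart x z v = 0 := h0
  rw [← toChart_fromChart hz v, h1, map_zero]

theorem metricInChart_symm (g : Metric n M) (x : M) (y v w : Coord n) :
    metricInChart g x y v w = metricInChart g x y w v :=
  metricAt_comm g _ _ _

theorem metricInChart_pos (g : Metric n M) {x : M} {y : Coord n}
    (hy : y ∈ (extChartAt (𝓡 n) x).target) (v : Coord n) (hv : v ≠ 0) :
    0 < metricInChart g x y v v :=
  bilinInChart_pos ((extChartAt (𝓡 n) x).map_target hy) (fun _ hv => metricAt_pos g _ hv) v hv

/-- Smoothness of the metric as a section, read in the bundle trivialization at `x`, is smoothness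
of its components. The work is in identifying the coordinates of the trivialization with
`fromChart`. -/
theorem contDiffOn_metricInChart (g : Metric n M) (x : M) :
    ContDiffOn ℝ ∞ (metricInChart g x) (extChartAt (𝓡 n) x).target := by
  set e := trivializationAt (Coord n →L[ℝ] Coord n →L[ℝ] ℝ)
    (fun z : M => TangentSpace (𝓡 n) z →L[ℝ] TangentSpace (𝓡 n) z →L[ℝ] ℝ) x with he
  have h1 := (e.contMDiffOn_iff (IM := 𝓡 n) (IB := 𝓡 n) (n := ∞)
    (s := (extChartAt (𝓡 n) x).source)
    (f := fun b => TotalSpace.mk' (Coord n →L[ℝ] Coord n →L[ℝ] ℝ) b (g.inner b)) (by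
      intro z hz
      rw [extChartAt_source] at hz
      simpa [he] using hz)).1 g.contMDiff.contMDiffOn
  have h2 := (h1.2.comp (contMDiffOn_extChartAt_symm (I := 𝓡 n) x)
    (extChartAt (𝓡 n) x).mapsTo_symm).contDiffOn
  refine h2.congr fun y hy => ?_
  have hz : (extChartAt (𝓡 n) x).symm y ∈ (chartAt (Coord n) x).source := by
    rw [← extChartAt_source (𝓡 n)]
    exact (extChartAt (𝓡 n) x).map_target hy
  set z := (extChartAt (𝓡 n) x).symm y
  ext v w
  have h3 := inCoordinates_apply_eq₂ (F₁ := Coord n) (F₂ := Coord n) (F₃ := ℝ) (𝕜 := ℝ)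
    (E₁ := fun z : M => TangentSpace (𝓡 n) z) (E₂ := fun z : M => TangentSpace (𝓡 n) z)
    (E₃ := fun _ : M => ℝ) (x₀ := x) (x := z) (ϕ := g.inner z) (v := v) (w := w) hz hz trivial
  have h4 (v : Coord n) : (trivializationAt (Coord n) (fun z : M => TangentSpace (𝓡 n) z) x).symm z v
      = fromChart x z v := by
    rw [← Trivialization.symmL_apply (R := ℝ),
      TangentBundle.symmL_trivializationAt_eq_core hz]
    · rfl
    · exact hz
  rw [h4, h4] at h3
  refine Eq.trans ?_ h3.symm
  rw [Trivialization.linearMapAt_apply]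
  simp
  rfl

theorem isMetricNear_metricInChart (g : Metric n M) {x : M} {y : Coord n}
    (hy : y ∈ (extChartAt (𝓡 n) x).target) : IsMetricNear (metricInChart g x) y where
  contDiffAt := (contDiffOn_metricInChart g x).contDiffAt
    ((isOpen_extChartAt_target x).mem_nhds hy)
  symm := Eventually.of_forall (metricInChart_symm g x)
  invertible := by
    filter_upwards [(isOpen_extChartAt_target x).mem_nhds hy] with z hz
    exact isInvertible_of_pos (metricInChart_pos g hz)

theorem isMetricNear_metricInChart_self (g : Metric n M) (x : M) :
    IsMetricNear (metricInChart g x) (extChartAt (𝓡 n) x x) :=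
  isMetricNear_metricInChart g (mem_extChartAt_target x)

theorem ricci_comm (g : Metric n M) (x : M) (v w : Coord n) : ricci g x v w = ricci g x w v :=
  traceBilin_riemann_comm (isMetricNear_metricInChart_self g x) v w

/-- The only property of the Rho-tensor that the main argument needs; it reconciles $\mathrm
P_{ab}U^b$ in the jerk with $U^a\mathrm P_{ab}$ in the connection. -/
theorem IsRhoTensor.symm {g : Metric n M} {P : M → Bilin n} (h : IsRhoTensor g P) (x : M)
    (v w : Coord n) : P x v w = P x w v := by
  rcases h with ⟨_, rfl⟩ | ⟨_, _, h⟩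
  · simp [schouten, ricci_comm g x v w, metricAt_comm g x v w]
  · exact h x v w

end Manifold

theorem contDiffAt_deriv {F : Type*} [NormedAddCommGroup F] [NormedSpace ℝ F] {f : ℝ → F} {t : ℝ}
    (hf : ContDiffAt ℝ ∞ f t) : ContDiffAt ℝ ∞ (deriv f) t := by
  have h := (hf.fderiv_right (m := ∞) (by simp)).clm_apply (contDiffAt_const (c := (1 : ℝ)))
  exact h

/-! ### Covariance of the Euler-Lagrange expression of the energy. -/

section EulerLagrange

variable {E : Type*} [NormedAddCommGroup E] [NormedSpace ℝ E]

/-- The Euler-Lagrange expression `a (G(y)u)' - ½ dG(·)(u,u)` of the energy of the metric `G`, for a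
vector field `u` along the curve `y`. -/
noncomputable def eulerLagrange (a : ℝ) (G : E → E →L[ℝ] E →L[ℝ] ℝ) (y u : ℝ → E) (t : ℝ) :
    E →L[ℝ] ℝ :=
  a • deriv (fun r => G (y r) (u r)) t - (1 / 2 : ℝ) • ((fderiv ℝ G (y t)).flip (u t)).flip (u t)

theorem eulerLagrange_apply (a : ℝ) (G : E → E →L[ℝ] E →L[ℝ] ℝ) (y u : ℝ → E) (t : ℝ) (w : E) :
    eulerLagrange a G y u t w =
      a * deriv (fun r => G (y r) (u r)) t w - 1 / 2 * fderiv ℝ G (y t) w (u t) (u t) := by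
  simp [eulerLagrange]

/-- The Euler-Lagrange expression is a covector. -/
theorem eulerLagrange_pullback {c : ℝ} (hc : c ≠ 0) {G₀ G₁ : E → E →L[ℝ] E →L[ℝ] ℝ} {ψ : E → E}
    {y u₀ u₁ : ℝ → E} {t : ℝ} (hy : HasDerivAt y (c • u₀ t) t) (hu : DifferentiableAt ℝ u₀ t)
    (hψ : ContDiffAt ℝ ∞ ψ (y t)) (hG₁ : DifferentiableAt ℝ G₁ (ψ (y t)))
    (hsymm : ∀ v w, G₁ (ψ (y t)) v w = G₁ (ψ (y t)) w v)
    (hG : ∀ᶠ z in 𝓝 (y t), ∀ v w, G₀ z v w = G₁ (ψ z) (fderiv ℝ ψ z v) (fderiv ℝ ψ z w))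
    (hu₁ : u₁ =ᶠ[𝓝 t] fun r => fderiv ℝ ψ (y r) (u₀ r)) (w : E) :
    eulerLagrange c⁻¹ G₀ y u₀ t w =
      eulerLagrange c⁻¹ G₁ (fun r => ψ (y r)) u₁ t (fderiv ℝ ψ (y t) w) := by
  have hψ1 : HasFDerivAt ψ (fderiv ℝ ψ (y t)) (y t) :=
    (hψ.differentiableAt (by simp)).hasFDerivAt
  have hψ2 : HasFDerivAt (fderiv ℝ ψ) (fderiv ℝ (fderiv ℝ ψ) (y t)) (y t) :=
    ((hψ.fderiv_right (m := ∞) (by simp)).differentiableAt (by simp)).hasFDerivAt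
  have hsym : IsSymmSndFDerivAt ℝ ψ (y t) :=
    hψ.isSymmSndFDerivAt (by simpa using ENat.LEInfty.out)
  have hut := hu₁.self_of_nhds
  have hGψ : HasFDerivAt (fun z => G₁ (ψ z)) ((fderiv ℝ G₁ (ψ (y t))).comp (fderiv ℝ ψ (y t)))
    (y t) := hG₁.hasFDerivAt.comp (y t) hψ1
  have hpull (v v' : E) := ((hGψ.clm_apply (hψ2.clm_apply (hasFDerivAt_const v (y t)))).clm_apply
    (hψ2.clm_apply (hasFDerivAt_const v' (y t))))
  -- `G₀` is known only as a pullback near `y t`, so its differentiability is read off the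
  -- composite.
  have hG₀ : DifferentiableAt ℝ G₀ (y t) := by
    have : (fun z => ((ContinuousLinearMap.compL ℝ E E ℝ).flip (fderiv ℝ ψ z)).comp
        ((G₁ (ψ z)).comp (fderiv ℝ ψ z))) =ᶠ[𝓝 (y t)] G₀ := by
      filter_upwards [hG] with z hz
      ext v v'
      simp [hz]
    refine DifferentiableAt.congr_of_eventuallyEq ?_ this.symm
    exact (((ContinuousLinearMap.compL ℝ E E ℝ).flip.differentiableAt.comp (y t)
      hψ2.differentiableAt)).clm_comp (hGψ.differentiableAt.clm_comp hψ2.differentiableAt)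
  have hfd (w v v' : E) : fderiv ℝ G₀ (y t) w v v' =
      fderiv ℝ G₁ (ψ (y t)) (fderiv ℝ ψ (y t) w) (fderiv ℝ ψ (y t) v) (fderiv ℝ ψ (y t) v')
      + G₁ (ψ (y t)) (fderiv ℝ (fderiv ℝ ψ) (y t) w v) (fderiv ℝ ψ (y t) v')
      + G₁ (ψ (y t)) (fderiv ℝ ψ (y t) v) (fderiv ℝ (fderiv ℝ ψ) (y t) w v') := by
    have h1 := (hG₀.hasFDerivAt.clm_apply (hasFDerivAt_const v (y t))).clm_apply
      (hasFDerivAt_const v' (y t))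
    have h2 : (fun z => G₀ z v v') =ᶠ[𝓝 (y t)]
        fun z => G₁ (ψ z) (fderiv ℝ ψ z v) (fderiv ℝ ψ z v') := by
      filter_upwards [hG] with z hz using hz v v'
    have h3 := congrArg (fun L : E →L[ℝ] ℝ => L w)
      (h1.unique ((hpull v v').congr_of_eventuallyEq h2))
    simp at h3
    linarith
  have hDψ : HasDerivAt (fun r => fderiv ℝ ψ (y r)) (fderiv ℝ (fderiv ℝ ψ) (y t) (c • u₀ t)) t :=
    hψ2.comp_hasDerivAt t hy
  have hq₁ : DifferentiableAt ℝ (fun r => G₁ (ψ (y r)) (u₁ r)) t := by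
    refine (hGψ.comp_hasDerivAt t hy).differentiableAt.clm_apply ?_
    exact (hDψ.differentiableAt.clm_apply hu).congr_of_eventuallyEq hu₁
  have hq₀ : DifferentiableAt ℝ (fun r => G₀ (y r) (u₀ r)) t :=
    (hG₀.hasFDerivAt.comp_hasDerivAt t hy).differentiableAt.clm_apply hu
  -- The pushforward of the constant vector `w` varies along the curve; this produces the term in
  -- the second derivative of `ψ`.
  have hq : deriv (fun r => G₀ (y r) (u₀ r)) t w =
      deriv (fun r => G₁ (ψ (y r)) (u₁ r)) t (fderiv ℝ ψ (y t) w)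
      + c * G₁ (ψ (y t)) (u₁ t) (fderiv ℝ (fderiv ℝ ψ) (y t) (u₀ t) w) := by
    have h1 := hq₀.hasDerivAt.clm_apply (hasDerivAt_const t w)
    have h2 := hq₁.hasDerivAt.clm_apply (hDψ.clm_apply (hasDerivAt_const t w))
    have h3 : (fun r => G₀ (y r) (u₀ r) w) =ᶠ[𝓝 t]
        fun r => G₁ (ψ (y r)) (u₁ r) (fderiv ℝ ψ (y r) w) := by
      filter_upwards [hy.continuousAt.eventually hG, hu₁] with r h4 h5
      rw [h4, h5]
    have h4 := h1.unique (h2.congr_of_eventuallyEq h3)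
    simp at h4
    linarith
  -- The two second-derivative terms of `ψ` in `hfd` become equal by symmetry of the metric; half
  -- their sum cancels the term in `hq`, because $D^2\psi$ is symmetric and $c^{-1}c=1$.
  rw [eulerLagrange_apply, eulerLagrange_apply, hq, hfd, hsymm (fderiv ℝ (fderiv ℝ ψ) (y t) w _),
    hsym.eq w (u₀ t), hut]
  field_simp
  ring

end EulerLagrange

/-! ### Smoothness of speed, unit tangent and acceleration in a fixed chart. -/

section Curve

variable {n : ℕ} {M : Type*} [TopologicalSpace M] [ChartedSpace (Coord n) M]

/-- The coordinates of a curve in the preferred chart at `x`. -/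
noncomputable def chartCurve (n : ℕ) {M : Type*} [TopologicalSpace M]
    [ChartedSpace (Coord n) M] (x : M) (γ : ℝ → M) (t : ℝ) : Coord n := extChartAt (𝓡 n) x (γ t)

variable {γ : ℝ → M} {s : Set ℝ}

theorem chart_transition_eventuallyEq {x z q : M} (hx : q ∈ (extChartAt (𝓡 n) x).source)
    (hz : q ∈ (extChartAt (𝓡 n) z).source) :
    ∀ᶠ y in 𝓝 (extChartAt (𝓡 n) x q), y ∈ (extChartAt (𝓡 n) x).target ∧
      (extChartAt (𝓡 n) x).symm y ∈ (extChartAt (𝓡 n) z).source := by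
  have h1 : (extChartAt (𝓡 n) x).target ∈ 𝓝 (extChartAt (𝓡 n) x q) :=
    (isOpen_extChartAt_target x).mem_nhds ((extChartAt (𝓡 n) x).map_source hx)
  have h2 := (continuousAt_extChartAt_symm' (I := 𝓡 n) hx).preimage_mem_nhds
    ((isOpen_extChartAt_source (I := 𝓡 n) z).mem_nhds
      (by rwa [(extChartAt (𝓡 n) x).left_inv hx]))
  filter_upwards [h1, h2] with y hy1 hy2 using ⟨hy1, hy2⟩

theorem IsRegularCurve.contMDiffAt (hγ : IsRegularCurve n γ s) {t : ℝ} (ht : t ∈ s) :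
    ContMDiffAt 𝓘(ℝ, ℝ) (𝓡 n) ∞ γ t :=
  hγ.contMDiffOn.contMDiffAt (hγ.isOpen.mem_nhds ht)

theorem IsRegularCurve.eventually (hγ : IsRegularCurve n γ s) {t : ℝ} (ht : t ∈ s) {x : M}
    (hx : γ t ∈ (extChartAt (𝓡 n) x).source) :
    ∀ᶠ r in 𝓝 t, r ∈ s ∧ γ r ∈ (extChartAt (𝓡 n) x).source :=
  (eventually_mem_set.2 (hγ.isOpen.mem_nhds ht)).and
    ((hγ.contMDiffAt ht).continuousAt.preimage_mem_nhds
      ((isOpen_extChartAt_source (I := 𝓡 n) x).mem_nhds hx))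

theorem IsRegularCurve.chartCurve_transition (hγ : IsRegularCurve n γ s) {t : ℝ} (ht : t ∈ s)
    {x : M} (hx : γ t ∈ (extChartAt (𝓡 n) x).source) (z : M) :
    chartCurve n z γ =ᶠ[𝓝 t]
      fun r => (extChartAt (𝓡 n) z ∘ (extChartAt (𝓡 n) x).symm) (chartCurve n x γ r) := by
  filter_upwards [hγ.eventually ht hx] with r hr
  simp only [chartCurve, Function.comp_apply]
  rw [(extChartAt (𝓡 n) x).left_inv hr.2]

variable [IsManifold (𝓡 n) ∞ M]

/-- The components of the unit tangent vector in the preferred chart at `x`. -/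
noncomputable def chartUnit (g : Metric n M) (x : M) (γ : ℝ → M) (t : ℝ) : Coord n :=
  toChart x (γ t) (unitTangent g γ t)

theorem hasFDerivAt_chart_transition {x z q : M} (hx : q ∈ (extChartAt (𝓡 n) x).source)
    (hz : q ∈ (extChartAt (𝓡 n) z).source) :
    HasFDerivAt (extChartAt (𝓡 n) z ∘ (extChartAt (𝓡 n) x).symm) (tangentCoordChange (𝓡 n) x z q)
      (extChartAt (𝓡 n) x q) := by
  have h := hasFDerivWithinAt_tangentCoordChange (I := 𝓡 n) (x := x) (y := z) (z := q) ⟨hx, hz⟩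
  rwa [ModelWithCorners.range_eq_univ, hasFDerivWithinAt_univ] at h

theorem contDiffAt_chart_transition {x z q : M} (hx : q ∈ (extChartAt (𝓡 n) x).source)
    (hz : q ∈ (extChartAt (𝓡 n) z).source) :
    ContDiffAt ℝ ∞ (extChartAt (𝓡 n) z ∘ (extChartAt (𝓡 n) x).symm) (extChartAt (𝓡 n) x q) := by
  have h := contDiffWithinAt_ext_coord_change (I := 𝓡 n) (n := ∞) z x
    (y := extChartAt (𝓡 n) x q) (by
      rw [PartialEquiv.trans_source'', PartialEquiv.symm_symm, PartialEquiv.symm_target]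
      exact mem_image_of_mem _ ⟨hx, hz⟩)
  rwa [ModelWithCorners.range_eq_univ, contDiffWithinAt_univ] at h

variable {g : Metric n M}

theorem IsRegularCurve.contDiffAt_chartCurve (hγ : IsRegularCurve n γ s) {t : ℝ} (ht : t ∈ s)
    {x : M} (hx : γ t ∈ (extChartAt (𝓡 n) x).source) : ContDiffAt ℝ ∞ (chartCurve n x γ) t := by
  have h1 : ContMDiffAt (𝓡 n) 𝓘(ℝ, Coord n) ∞ (extChartAt (𝓡 n) x) (γ t) :=
    (contMDiffOn_extChartAt (I := 𝓡 n) (x := x)).contMDiffAt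
      (by rw [← extChartAt_source (𝓡 n)]; exact (isOpen_extChartAt_source x).mem_nhds hx)
  exact (h1.comp t (hγ.contMDiffAt ht)).contDiffAt

theorem IsRegularCurve.hasDerivAt_chartCurve (hγ : IsRegularCurve n γ s) {t : ℝ} (ht : t ∈ s)
    {x : M} (hx : γ t ∈ (extChartAt (𝓡 n) x).source) :
    HasDerivAt (chartCurve n x γ) (toChart x (γ t) (velocity n γ t)) t := by
  have h0 := mem_extChartAt_source (I := 𝓡 n) (γ t)
  have h1 : HasDerivAt (chartCurve n (γ t) γ) (velocity n γ t) t := by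
    have h2 := ((hγ.contDiffAt_chartCurve ht h0).differentiableAt (by simp)).hasDerivAt
    have h3 : velocity n γ t = deriv (chartCurve n (γ t) γ) t := by
      rw [velocity, ((hγ.contMDiffAt ht).mdifferentiableAt (by simp)).mfderiv]
      change fderivWithin ℝ (chartCurve n (γ t) γ) (range 𝓘(ℝ, ℝ)) t 1 = _
      rw [ModelWithCorners.range_eq_univ, fderivWithin_univ, fderiv_apply_one_eq_deriv]
    rwa [h3]
  refine HasDerivAt.congr_of_eventuallyEq ?_ (hγ.chartCurve_transition ht h0 x)
  exact (hasFDerivAt_chart_transition h0 hx).comp_hasDerivAt t h1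

theorem IsRegularCurve.speed_pos (hγ : IsRegularCurve n γ s) {t : ℝ} (ht : t ∈ s) :
    0 < speed g γ t :=
  Real.sqrt_pos.2 (metricAt_pos g _ (hγ.velocity_ne_zero t ht))

theorem IsRegularCurve.metricAt_unitTangent (hγ : IsRegularCurve n γ s) {t : ℝ} (ht : t ∈ s) :
    metricAt g (γ t) (unitTangent g γ t) (unitTangent g γ t) = 1 := by
  have h1 := hγ.speed_pos (g := g) ht
  have h2 : speed g γ t ^ 2 = metricAt g (γ t) (velocity n γ t) (velocity n γ t) :=
    Real.sq_sqrt (metricAt_pos g _ (hγ.velocity_ne_zero t ht)).le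
  simp only [unitTangent, map_smul, smul_apply, smul_eq_mul, ← h2]
  field_simp

theorem IsRegularCurve.hasDerivAt_chartCurve_unit (hγ : IsRegularCurve n γ s) {t : ℝ} (ht : t ∈ s)
    {x : M} (hx : γ t ∈ (extChartAt (𝓡 n) x).source) :
    HasDerivAt (chartCurve n x γ) (speed g γ t • chartUnit g x γ t) t := by
  have h1 := hγ.speed_pos (g := g) ht
  have h2 := hγ.hasDerivAt_chartCurve ht hx
  rw [chartUnit, unitTangent, map_smul, smul_smul, mul_inv_cancel₀ h1.ne', one_smul]
  exact h2

theorem metricInChart_toChart (g : Metric n M) {x z : M} (hz : z ∈ (extChartAt (𝓡 n) x).source)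
    (v : Coord n) :
    metricInChart g x (extChartAt (𝓡 n) x z) (toChart x z v) =
      covectorInChart x z (metricAt g z v) := by
  ext w
  rw [metricInChart_extChartAt g hz, bilinInChart_apply, covectorInChart_apply,
    fromChart_toChart hz]

theorem IsRegularCurve.contDiffAt_metricInChart (hγ : IsRegularCurve n γ s) {t : ℝ} (ht : t ∈ s)
    {x : M} (hx : γ t ∈ (extChartAt (𝓡 n) x).source) :
    ContDiffAt ℝ ∞ (fun r => metricInChart g x (chartCurve n x γ r)) t :=
  ContDiffAt.comp (g := metricInChart g x) t
    (isMetricNear_metricInChart g ((extChartAt (𝓡 n) x).map_source hx)).contDiffAt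
    (hγ.contDiffAt_chartCurve ht hx)

theorem IsRegularCurve.contDiffAt_speed (hγ : IsRegularCurve n γ s) {t : ℝ} (ht : t ∈ s) :
    ContDiffAt ℝ ∞ (speed g γ) t := by
  have hx := mem_extChartAt_source (I := 𝓡 n) (γ t)
  have hd := contDiffAt_deriv (hγ.contDiffAt_chartCurve ht hx)
  have h1 := ((hγ.contDiffAt_metricInChart (g := g) ht hx).clm_apply hd).clm_apply hd
  -- `velocity n γ r` has components in the chart at `γ r`, which moves with `r`; in the fixed chart
  -- it is the derivative of the coordinates.
  have h2 : (fun r => metricAt g (γ r) (velocity n γ r) (velocity n γ r)) =ᶠ[𝓝 t]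
      fun r => metricInChart g (γ t) (chartCurve n (γ t) γ r) (deriv (chartCurve n (γ t) γ) r)
        (deriv (chartCurve n (γ t) γ) r) := by
    filter_upwards [hγ.eventually ht hx] with r hr
    rw [(hγ.hasDerivAt_chartCurve hr.1 hr.2).deriv, chartCurve, metricInChart_toChart g hr.2,
      covectorInChart_apply, fromChart_toChart hr.2]
  exact (h1.congr_of_eventuallyEq h2).sqrt (metricAt_pos g _ (hγ.velocity_ne_zero t ht)).ne'

theorem IsRegularCurve.contDiffAt_chartUnit (hγ : IsRegularCurve n γ s) {t : ℝ} (ht : t ∈ s)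
    {x : M} (hx : γ t ∈ (extChartAt (𝓡 n) x).source) :
    ContDiffAt ℝ ∞ (chartUnit g x γ) t := by
  have h1 := ((hγ.contDiffAt_speed (g := g) ht).inv (hγ.speed_pos ht).ne').smul
    (contDiffAt_deriv (hγ.contDiffAt_chartCurve ht hx))
  refine h1.congr_of_eventuallyEq ?_
  filter_upwards [hγ.eventually ht hx] with r hr
  simp only [chartUnit, unitTangent, map_smul]
  rw [← (hγ.hasDerivAt_chartCurve hr.1 hr.2).deriv]
  rfl

theorem IsRegularCurve.unitCovector_inChart (hγ : IsRegularCurve n γ s) {t : ℝ} (ht : t ∈ s)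
    {x : M} (hx : γ t ∈ (extChartAt (𝓡 n) x).source) :
    (fun r => covectorInChart x (γ r) (unitCovector g γ r)) =ᶠ[𝓝 t]
      fun r => metricInChart g x (chartCurve n x γ r) (chartUnit g x γ r) := by
  filter_upwards [hγ.eventually ht hx] with r hr
  rw [unitCovector, chartCurve, chartUnit, metricInChart_toChart g hr.2]

/-- The connection term is $g(U,\Gamma(U,w))=\tfrac12\,\partial_w g(U,U)$, the other two derivatives
of the metric cancelling. In this form covariance needs no transformation law for Christoffel
symbols. -/
theorem IsRegularCurve.acceleration_eq_eulerLagrange (hγ : IsRegularCurve n γ s) {t : ℝ}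
    (ht : t ∈ s) :
    acceleration g γ t = eulerLagrange (speed g γ t)⁻¹ (metricInChart g (γ t))
      (chartCurve n (γ t) γ) (chartUnit g (γ t) γ) t := by
  have hx := mem_extChartAt_source (I := 𝓡 n) (γ t)
  have hm := isMetricNear_metricInChart_self g (γ t)
  ext w
  rw [eulerLagrange_apply, acceleration, partialCovector, covDerivCovector,
    (hγ.unitCovector_inChart ht hx).deriv_eq]
  simp only [sub_apply, smul_apply, smul_eq_mul, ContinuousLinearMap.comp_apply, connectionAlong,
    unitCovector, chartUnit, toChart_self]
  rw [metricAt_comm, ← metricInChart_self,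
    IsMetricNear.apply_christoffel hm.invertible.self_of_nhds, christoffelFirst_apply,
    IsMetricNear.fderiv_symm_of_eventually hm.differentiableAt hm.symm _ w]
  simp only [chartCurve]
  ring

theorem metricInChart_transition (g : Metric n M) {x z q : M}
    (hx : q ∈ (extChartAt (𝓡 n) x).source) (hz : q ∈ (extChartAt (𝓡 n) z).source) :
    ∀ᶠ y in 𝓝 (extChartAt (𝓡 n) x q), ∀ v w, metricInChart g x y v w =
      metricInChart g z ((extChartAt (𝓡 n) z ∘ (extChartAt (𝓡 n) x).symm) y)
        (fderiv ℝ (extChartAt (𝓡 n) z ∘ (extChartAt (𝓡 n) x).symm) y v)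
        (fderiv ℝ (extChartAt (𝓡 n) z ∘ (extChartAt (𝓡 n) x).symm) y w) := by
  filter_upwards [chart_transition_eventuallyEq hx hz] with y ⟨hy1, hy2⟩ v w
  have hy3 := (extChartAt (𝓡 n) x).map_target hy1
  have h1 := (hasFDerivAt_chart_transition hy3 hy2).fderiv
  rw [(extChartAt (𝓡 n) x).right_inv hy1] at h1
  have h2 (v : Coord n) : fromChart z ((extChartAt (𝓡 n) x).symm y)
      (tangentCoordChange (𝓡 n) x z ((extChartAt (𝓡 n) x).symm y) v) =
      fromChart x ((extChartAt (𝓡 n) x).symm y) v :=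
    tangentCoordChange_comp ⟨⟨hy3, hy2⟩, mem_extChartAt_source _⟩
  rw [h1, Function.comp_apply, metricInChart_extChartAt g hy2, bilinInChart_apply, h2, h2]
  rfl

/-- Transports the formula for $A$ from the preferred chart at `γ t` to any chart around it, so that
the accelerations at nearby points can be compared in one chart. -/
theorem IsRegularCurve.acceleration_inChart (hγ : IsRegularCurve n γ s) {t : ℝ} (ht : t ∈ s)
    {x : M} (hx : γ t ∈ (extChartAt (𝓡 n) x).source) :
    covectorInChart x (γ t) (acceleration g γ t) = eulerLagrange (speed g γ t)⁻¹
      (metricInChart g x) (chartCurve n x γ) (chartUnit g x γ) t := by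
  have hz := mem_extChartAt_source (I := 𝓡 n) (γ t)
  have hψ (r : ℝ) (hr : γ r ∈ (extChartAt (𝓡 n) x).source)
      (hr' : γ r ∈ (extChartAt (𝓡 n) (γ t)).source) :
      fderiv ℝ (extChartAt (𝓡 n) (γ t) ∘ (extChartAt (𝓡 n) x).symm) (chartCurve n x γ r) =
        tangentCoordChange (𝓡 n) x (γ t) (γ r) :=
    (hasFDerivAt_chart_transition hr hr').fderiv
  have hψt : (extChartAt (𝓡 n) (γ t) ∘ (extChartAt (𝓡 n) x).symm) (chartCurve n x γ t) =
      extChartAt (𝓡 n) (γ t) (γ t) := by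
    rw [Function.comp_apply, chartCurve, (extChartAt (𝓡 n) x).left_inv hx]
  ext w
  rw [eulerLagrange_pullback (hγ.speed_pos ht).ne' (G₁ := metricInChart g (γ t))
    (ψ := extChartAt (𝓡 n) (γ t) ∘ (extChartAt (𝓡 n) x).symm)
    (u₁ := chartUnit g (γ t) γ) (hγ.hasDerivAt_chartCurve_unit ht hx)
    ((hγ.contDiffAt_chartUnit ht hx).differentiableAt (by simp))
    (contDiffAt_chart_transition hx hz)
    (by rw [hψt]; exact (isMetricNear_metricInChart_self g (γ t)).differentiableAt)
    (metricInChart_symm g _ _) (metricInChart_transition g hx hz) ?_ w, hψ t hx hz,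
    covectorInChart_apply, hγ.acceleration_eq_eulerLagrange ht, fromChart]
  · have he := hγ.chartCurve_transition ht hx (γ t)
    rw [eulerLagrange_apply, eulerLagrange_apply]
    rw [he.self_of_nhds]
    congr 3
    refine EventuallyEq.deriv_eq ?_
    filter_upwards [he] with r hr
    rw [hr]
  · filter_upwards [hγ.eventually ht hx, hγ.eventually ht hz] with r hr hr'
    rw [hψ r hr.2 hr'.2]
    exact (tangentCoordChange_comp ⟨⟨mem_extChartAt_source _, hr.2⟩, hr'.2⟩).symm

/-- Ensures that the derivative of $A$ inside $J$ is a genuine one and not the default value zero of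
`deriv`. -/
theorem IsRegularCurve.contDiffAt_acceleration (hγ : IsRegularCurve n γ s) {t : ℝ} (ht : t ∈ s)
    {x : M} (hx : γ t ∈ (extChartAt (𝓡 n) x).source) :
    ContDiffAt ℝ ∞ (fun r => covectorInChart x (γ r) (acceleration g γ r)) t := by
  have hu := hγ.contDiffAt_chartUnit (g := g) ht hx
  have hm := isMetricNear_metricInChart g ((extChartAt (𝓡 n) x).map_source hx)
  have hfd : ContDiffAt ℝ ∞ (fun r => fderiv ℝ (metricInChart g x) (chartCurve n x γ r)) t :=
    ContDiffAt.comp t hm.contDiffAt_fderiv (hγ.contDiffAt_chartCurve ht hx)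
  have h1 : ContDiffAt ℝ ∞ (fun r => (((fderiv ℝ (metricInChart g x) (chartCurve n x γ r)).flip
      (chartUnit g x γ r)).flip (chartUnit g x γ r))) t := by
    have hf := ((ContinuousLinearMap.flipₗᵢ ℝ (Coord n) (Coord n) (Covector n) :
      (Coord n →L[ℝ] Coord n →L[ℝ] Covector n) →L[ℝ]
        (Coord n →L[ℝ] Coord n →L[ℝ] Covector n)).contDiff (n := ∞)).contDiffAt.comp t hfd
    have hf' := ((ContinuousLinearMap.flipₗᵢ ℝ (Coord n) (Coord n) ℝ :
      Bilin n →L[ℝ] Bilin n).contDiff (n := ∞)).contDiffAt.comp t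
      (hf.clm_apply hu)
    exact hf'.clm_apply hu
  have h2 : ContDiffAt ℝ ∞ (fun r => eulerLagrange (speed g γ r)⁻¹ (metricInChart g x)
      (chartCurve n x γ) (chartUnit g x γ) r) t :=
    (((hγ.contDiffAt_speed (g := g) ht).inv (hγ.speed_pos ht).ne').smul (contDiffAt_deriv
      ((hγ.contDiffAt_metricInChart ht hx).clm_apply hu))).sub
      ((contDiffAt_const (c := (1 / 2 : ℝ))).smul h1)
  refine h2.congr_of_eventuallyEq ?_
  filter_upwards [hγ.eventually ht hx] with r hr
  exact hγ.acceleration_inChart hr.1 hr.2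

end Curve

/-! ### Leibniz rules for the covariant derivative along a curve. -/

section CovariantDerivative

variable {E : Type*} [NormedAddCommGroup E] [NormedSpace ℝ E]

/-- The covariant derivative `a v' + Γ_U v` of a vector field along a curve. -/
noncomputable def covDerivVector (a : ℝ) (Γ_U : E →L[ℝ] E) (v : ℝ → E) (t : ℝ) : E :=
  a • deriv v t + Γ_U (v t)

variable {a : ℝ} {Γ_U : E →L[ℝ] E} {t : ℝ}

theorem covDerivCovector_apply_add {f : ℝ → E →L[ℝ] ℝ} {v : ℝ → E} (hf : DifferentiableAt ℝ f t)
    (hv : DifferentiableAt ℝ v t) :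
    covDerivCovector a Γ_U f (f t) t (v t) + f t (covDerivVector a Γ_U v t) =
      a * deriv (fun r => f r (v r)) t := by
  rw [(hf.hasDerivAt.clm_apply hv.hasDerivAt).deriv]
  simp [covDerivCovector, covDerivVector]
  ring

theorem covDerivCovector_smul {c : ℝ → ℝ} {f : ℝ → E →L[ℝ] ℝ} (hc : DifferentiableAt ℝ c t)
    (hf : DifferentiableAt ℝ f t) :
    covDerivCovector a Γ_U (fun r => c r • f r) (c t • f t) t =
      (a * deriv c t) • f t + c t • covDerivCovector a Γ_U f (f t) t := by
  have h := (hc.hasDerivAt.smul hf.hasDerivAt).deriv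
  ext w
  simp only [covDerivCovector]
  rw [show (fun r => c r • f r) = c • f from rfl, h]
  simp
  ring

theorem covDerivCovector_add {f f' : ℝ → E →L[ℝ] ℝ} (hf : DifferentiableAt ℝ f t)
    (hf' : DifferentiableAt ℝ f' t) :
    covDerivCovector a Γ_U (fun r => f r + f' r) (f t + f' t) t =
      covDerivCovector a Γ_U f (f t) t + covDerivCovector a Γ_U f' (f' t) t := by
  have h := (hf.hasDerivAt.add hf'.hasDerivAt).deriv
  ext w
  simp only [covDerivCovector]
  rw [show (fun r => f r + f' r) = f + f' from rfl, h]
  simp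
  ring

theorem covDerivCovector_bilin_apply {m : ℝ → E →L[ℝ] E →L[ℝ] ℝ} {v : ℝ → E}
    (hm : DifferentiableAt ℝ m t) (hv : DifferentiableAt ℝ v t) :
    covDerivCovector a Γ_U (fun r => m r (v r)) (m t (v t)) t =
      covDerivBilin a Γ_U m (m t) t (v t) + m t (covDerivVector a Γ_U v t) := by
  ext w
  simp [covDerivCovector, covDerivBilin, covDerivVector,
    (hm.hasDerivAt.clm_apply hv.hasDerivAt).deriv]
  ring

theorem hasDerivAt_flip {m : ℝ → E →L[ℝ] E →L[ℝ] ℝ} (hm : DifferentiableAt ℝ m t) :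
    HasDerivAt (fun r => (m r).flip) (deriv m t).flip t :=
  ((ContinuousLinearMap.flipₗᵢ ℝ E E ℝ :
    (E →L[ℝ] E →L[ℝ] ℝ) →L[ℝ] (E →L[ℝ] E →L[ℝ] ℝ))).hasFDerivAt.comp_hasDerivAt t hm.hasDerivAt

theorem covDerivBilin_flip {m : ℝ → E →L[ℝ] E →L[ℝ] ℝ} (hm : DifferentiableAt ℝ m t) :
    covDerivBilin a Γ_U (fun r => (m r).flip) (m t).flip t =
      (covDerivBilin a Γ_U m (m t) t).flip := by
  ext v w
  simp [covDerivBilin, (hasDerivAt_flip hm).deriv]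
  ring

/-- Lowering an index commutes with $\partial$ because $\nabla g=0$; the speed `c` in the derivative
of `y` cancels the normalisation `c⁻¹`. -/
theorem covDerivCovector_metric {G : E → E →L[ℝ] E →L[ℝ] ℝ} {y v : ℝ → E} {u : E} {c : ℝ}
    (hc : c ≠ 0) (hG : IsMetricNear G (y t)) (hy : HasDerivAt y (c • u) t)
    (hv : DifferentiableAt ℝ v t) :
    covDerivCovector c⁻¹ (christoffel G (y t) u) (fun r => G (y r) (v r)) (G (y t) (v t)) t =
      G (y t) (covDerivVector c⁻¹ (christoffel G (y t) u) v t) := by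
  ext w
  have h := (hG.differentiableAt.hasFDerivAt.comp_hasDerivAt t hy).clm_apply hv.hasDerivAt
  have h1 : deriv (fun r => G (y r) (v r)) t = _ := h.deriv
  simp only [covDerivCovector, covDerivVector, h1]
  simp [hG.compat]
  field_simp
  ring

end CovariantDerivative

/-! ### The identities $\partial U=A$, $A(U)=0$ and $(\partial A)(U)=-|A|^2$. -/

section Curve

variable {n : ℕ} {M : Type*} [TopologicalSpace M] [ChartedSpace (Coord n) M]
  [IsManifold (𝓡 n) ∞ M] {g : Metric n M} {γ : ℝ → M} {s : Set ℝ}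

/-- The components of the acceleration vector in the preferred chart at `x`. -/
noncomputable def chartAcceleration (g : Metric n M) (x : M) (γ : ℝ → M) (t : ℝ) : Coord n :=
  toChart x (γ t) (accelerationVector g γ t)

theorem metricAt_accelerationVector (g : Metric n M) (γ : ℝ → M) (t : ℝ) :
    metricAt g (γ t) (accelerationVector g γ t) = acceleration g γ t :=
  (metricAt_isInvertible g (γ t)).self_apply_inverse _

theorem metricAt_sharp (g : Metric n M) (x : M) (α : Covector n) :
    metricAt g x (sharp g x α) = α :=
  (metricAt_isInvertible g x).self_apply_inverse _

theorem chartUnit_self (g : Metric n M) (γ : ℝ → M) (t : ℝ) :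
    chartUnit g (γ t) γ t = unitTangent g γ t :=
  toChart_self _ _

theorem chartAcceleration_self (g : Metric n M) (γ : ℝ → M) (t : ℝ) :
    chartAcceleration g (γ t) γ t = accelerationVector g γ t :=
  toChart_self _ _

theorem IsRegularCurve.differentiableAt_chartAcceleration (hγ : IsRegularCurve n γ s) {t : ℝ}
    (ht : t ∈ s) {x : M} (hx : γ t ∈ (extChartAt (𝓡 n) x).source) :
    DifferentiableAt ℝ (chartAcceleration g x γ) t := by
  have hm := isMetricNear_metricInChart g ((extChartAt (𝓡 n) x).map_source hx)
  have h1 : ContDiffAt ℝ ∞ (fun r => (metricInChart g x (chartCurve n x γ r)).inverse) t :=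
    ContDiffAt.comp (g := fun z => (metricInChart g x z).inverse) t hm.contDiffAt_inverse
      (hγ.contDiffAt_chartCurve ht hx)
  have h2 := (h1.clm_apply (hγ.contDiffAt_acceleration (g := g) ht hx)).differentiableAt (by simp)
  refine h2.congr_of_eventuallyEq ?_
  filter_upwards [hγ.eventually ht hx] with r hr
  have hinv := (isMetricNear_metricInChart g
    ((extChartAt (𝓡 n) x).map_source hr.2)).invertible.self_of_nhds
  rw [← metricAt_accelerationVector, ← metricInChart_toChart g hr.2, chartCurve,
    hinv.inverse_apply_self, chartAcceleration]

theorem connectionAlong_eq (g : Metric n M) (γ : ℝ → M) (t : ℝ) :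
    connectionAlong g γ t = christoffel (metricInChart g (γ t)) (chartCurve n (γ t) γ t)
      (unitTangent g γ t) :=
  rfl

/-- The covariant derivative along the curve commutes with raising and lowering indices. -/
theorem IsRegularCurve.covDerivCovector_metricInChart (hγ : IsRegularCurve n γ s) {t : ℝ}
    (ht : t ∈ s) {v : ℝ → Coord n} (hv : DifferentiableAt ℝ v t) :
    covDerivCovector (speed g γ t)⁻¹ (connectionAlong g γ t)
        (fun r => metricInChart g (γ t) (chartCurve n (γ t) γ r) (v r))
        (metricAt g (γ t) (v t)) t =
      metricAt g (γ t) (covDerivVector (speed g γ t)⁻¹ (connectionAlong g γ t) v t) := by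
  have hx := mem_extChartAt_source (I := 𝓡 n) (γ t)
  have h := hγ.hasDerivAt_chartCurve_unit (g := g) ht hx
  rw [chartUnit_self] at h
  have hm : metricInChart g (γ t) (chartCurve n (γ t) γ t) = metricAt g (γ t) :=
    metricInChart_self g (γ t)
  have h1 := covDerivCovector_metric (G := metricInChart g (γ t)) (y := chartCurve n (γ t) γ)
    (hγ.speed_pos (g := g) ht).ne' (isMetricNear_metricInChart_self g (γ t)) h hv
  rwa [hm, ← connectionAlong_eq] at h1

theorem covDerivCovector_congr {E : Type*} [NormedAddCommGroup E] [NormedSpace ℝ E] {a : ℝ}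
    {Γ_U : E →L[ℝ] E} {f f' : ℝ → E →L[ℝ] ℝ} {t : ℝ} (h : f =ᶠ[𝓝 t] f') (α : E →L[ℝ] ℝ) :
    covDerivCovector a Γ_U f α t = covDerivCovector a Γ_U f' α t := by
  rw [covDerivCovector, covDerivCovector, h.deriv_eq]

theorem IsRegularCurve.covDerivVector_chartUnit (hγ : IsRegularCurve n γ s) {t : ℝ} (ht : t ∈ s) :
    covDerivVector (speed g γ t)⁻¹ (connectionAlong g γ t) (chartUnit g (γ t) γ) t =
      accelerationVector g γ t := by
  have hx := mem_extChartAt_source (I := 𝓡 n) (γ t)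
  apply (metricAt_isInvertible g (γ t)).injective
  rw [← hγ.covDerivCovector_metricInChart ht
    ((hγ.contDiffAt_chartUnit ht hx).differentiableAt (by simp)), metricAt_accelerationVector,
    acceleration, partialCovector, covDerivCovector_congr (hγ.unitCovector_inChart ht hx),
    chartUnit_self, unitCovector]

theorem IsRegularCurve.acceleration_inChart_eventuallyEq (hγ : IsRegularCurve n γ s) {t : ℝ}
    (ht : t ∈ s) {x : M} (hx : γ t ∈ (extChartAt (𝓡 n) x).source) :
    (fun r => covectorInChart x (γ r) (acceleration g γ r)) =ᶠ[𝓝 t]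
      fun r => metricInChart g x (chartCurve n x γ r) (chartAcceleration g x γ r) := by
  filter_upwards [hγ.eventually ht hx] with r hr
  rw [chartCurve, chartAcceleration, metricInChart_toChart g hr.2, metricAt_accelerationVector]

theorem IsRegularCurve.metricAt_covDerivVector_chartAcceleration (hγ : IsRegularCurve n γ s)
    {t : ℝ} (ht : t ∈ s) :
    metricAt g (γ t) (covDerivVector (speed g γ t)⁻¹ (connectionAlong g γ t)
      (chartAcceleration g (γ t) γ) t) = partialCovector g γ (acceleration g γ) t := by
  have hx := mem_extChartAt_source (I := 𝓡 n) (γ t)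
  rw [← hγ.covDerivCovector_metricInChart ht (hγ.differentiableAt_chartAcceleration ht hx),
    partialCovector, covDerivCovector_congr (hγ.acceleration_inChart_eventuallyEq ht hx),
    chartAcceleration_self, metricAt_accelerationVector]

theorem unitCovector_apply_eq (g : Metric n M) (γ : ℝ → M) (t : ℝ) (α : Covector n) :
    unitCovector g γ t (sharp g (γ t) α) = α (unitTangent g γ t) := by
  rw [unitCovector, metricAt_comm, metricAt_sharp]

theorem IsRegularCurve.unitCovector_unitTangent (hγ : IsRegularCurve n γ s) {t : ℝ} (ht : t ∈ s) :
    unitCovector g γ t (unitTangent g γ t) = 1 :=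
  hγ.metricAt_unitTangent ht

theorem covectorInChart_chartUnit {x : M} {t : ℝ} (hx : γ t ∈ (extChartAt (𝓡 n) x).source)
    (α : Covector n) :
    covectorInChart x (γ t) α (chartUnit g x γ t) = α (unitTangent g γ t) := by
  rw [covectorInChart_apply, chartUnit, fromChart_toChart hx]

/-- The Leibniz rule for the function $\alpha(U)$, with $\partial U=A$. Taking $\alpha=U$ and then
$\alpha=A$ gives the orthogonality relations below. -/
theorem IsRegularCurve.partialCovector_apply_unitTangent (hγ : IsRegularCurve n γ s) {t : ℝ}
    (ht : t ∈ s)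
    {α : ℝ → Covector n}
    (hα : DifferentiableAt ℝ (fun r => covectorInChart (γ t) (γ r) (α r)) t) :
    partialCovector g γ α t (unitTangent g γ t) + α t (accelerationVector g γ t) =
      (speed g γ t)⁻¹ * deriv (fun r => α r (unitTangent g γ r)) t := by
  have hx := mem_extChartAt_source (I := 𝓡 n) (γ t)
  have h := covDerivCovector_apply_add (a := (speed g γ t)⁻¹) (Γ_U := connectionAlong g γ t) hα
    ((hγ.contDiffAt_chartUnit (g := g) ht hx).differentiableAt (by simp))
  have h2 : (fun r => covectorInChart (γ t) (γ r) (α r) (chartUnit g (γ t) γ r)) =ᶠ[𝓝 t]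
      fun r => α r (unitTangent g γ r) := by
    filter_upwards [hγ.eventually ht hx] with r hr using covectorInChart_chartUnit hr.2 _
  rwa [h2.deriv_eq, hγ.covDerivVector_chartUnit ht, chartUnit_self, covectorInChart_self] at h

theorem IsRegularCurve.differentiableAt_unitCovector (hγ : IsRegularCurve n γ s) {t : ℝ}
    (ht : t ∈ s) {x : M} (hx : γ t ∈ (extChartAt (𝓡 n) x).source) :
    DifferentiableAt ℝ (fun r => covectorInChart x (γ r) (unitCovector g γ r)) t :=
  (((hγ.contDiffAt_metricInChart (g := g) ht hx).clm_apply
    (hγ.contDiffAt_chartUnit ht hx)).differentiableAt (by simp)).congr_of_eventuallyEq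
    (hγ.unitCovector_inChart ht hx)

theorem IsRegularCurve.acceleration_unitTangent (hγ : IsRegularCurve n γ s) {t : ℝ} (ht : t ∈ s) :
    acceleration g γ t (unitTangent g γ t) = 0 := by
  have h := hγ.partialCovector_apply_unitTangent (g := g) ht
    (hγ.differentiableAt_unitCovector (g := g) ht (mem_extChartAt_source _))
  have h1 : (fun r => unitCovector g γ r (unitTangent g γ r)) =ᶠ[𝓝 t] fun _ => 1 := by
    filter_upwards [hγ.isOpen.mem_nhds ht] with r hr using hγ.unitCovector_unitTangent hr
  rw [h1.deriv_eq, deriv_const, mul_zero, accelerationVector, unitCovector_apply_eq] at h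
  change acceleration g γ t (unitTangent g γ t) + _ = 0 at h
  linarith

theorem IsRegularCurve.unitCovector_accelerationVector (hγ : IsRegularCurve n γ s) {t : ℝ}
    (ht : t ∈ s) : unitCovector g γ t (accelerationVector g γ t) = 0 := by
  rw [accelerationVector, unitCovector_apply_eq, hγ.acceleration_unitTangent ht]

theorem IsRegularCurve.partialCovector_acceleration_unitTangent (hγ : IsRegularCurve n γ s) {t : ℝ}
    (ht : t ∈ s) :
    partialCovector g γ (acceleration g γ) t (unitTangent g γ t) =
      -acceleration g γ t (accelerationVector g γ t) := by
  have h := hγ.partialCovector_apply_unitTangent (g := g) ht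
    ((hγ.contDiffAt_acceleration (g := g) ht (mem_extChartAt_source _)).differentiableAt (by simp))
  have h1 : (fun r => acceleration g γ r (unitTangent g γ r)) =ᶠ[𝓝 t] fun _ => 0 := by
    filter_upwards [hγ.isOpen.mem_nhds ht] with r hr using hγ.acceleration_unitTangent hr
  rw [h1.deriv_eq, deriv_const, mul_zero] at h
  linarith

end Curve

/-! ### Equations of the subbundle and its invariance under the tractor derivative. -/

section Curve

variable {n : ℕ} {M : Type*} [TopologicalSpace M] [ChartedSpace (Coord n) M]
  [IsManifold (𝓡 n) ∞ M] {g : Metric n M} {γ : ℝ → M} {s : Set ℝ}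

theorem wedge_apply (α β : Covector n) (v : Coord n) :
    (wedge α β : Bilin n) v = α v • β - β v • α := by
  ext w
  exact wedgeForm_apply α β v w

theorem TwoForm.flip_apply (μ : TwoForm n) (v : Coord n) :
    (μ : Bilin n).flip v = -(μ : Bilin n) v := by
  ext w
  exact skewForms_swap μ.2 w v

set_option synthInstance.maxHeartbeats 200000 in
theorem tractor_combination (a b c : ℝ) (u A ρ : Covector n) (w F : TwoForm n) :
    a • ((0, 0, 0, u) : Tractor n) + b • ((0, 0, 1, A) : Tractor n)
        + c • ((u, w, 0, 0) : Tractor n) + (0, F, 0, ρ) =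
      (c • u, c • w + F, b, a • u + b • A + ρ) := by
  refine Prod.ext ?_ (Prod.ext ?_ (Prod.ext ?_ ?_))
  · change a • (0 : Covector n) + b • (0 : Covector n) + c • u + 0 = c • u
    simp
  · change a • (0 : TwoForm n) + b • (0 : TwoForm n) + c • w + F = c • w + F
    simp
  · change a * 0 + b * 1 + c * 0 + 0 = b
    ring
  · change a • u + b • A + c • (0 : Covector n) + ρ = a • u + b • A + ρ
    simp

/-- Given the equations, subtracting $c\,U\wedge A$ from $\mu$ leaves a 2-form annihilated by $U$,
which supplies the $\mathcal C$-component; what remains lies in $\mathcal B$. -/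
theorem IsRegularCurve.mem_bundleS_iff (hγ : IsRegularCurve n γ s) {t : ℝ} (ht : t ∈ s)
    (z : Tractor n) :
    z ∈ bundleS g γ t ↔ ∃ c k : ℝ, z.1 = c • unitCovector g γ t ∧
      (z.2.1 : Bilin n) (unitTangent g γ t) = c • acceleration g γ t ∧
      z.2.2.2 = k • unitCovector g γ t + z.2.2.1 • acceleration g γ t
        + (z.2.1 : Bilin n).flip (accelerationVector g γ t) := by
  have hU := hγ.unitCovector_unitTangent (g := g) ht
  have hA := hγ.acceleration_unitTangent (g := g) ht
  have hA' := hγ.unitCovector_accelerationVector (g := g) ht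
  constructor
  · intro hz
    obtain ⟨y, hy, w, ⟨F, hF, rfl⟩, rfl⟩ := Submodule.mem_sup.1 hz
    obtain ⟨a, b, c, rfl⟩ := Submodule.mem_span_triple.1 hy
    rw [tractor_combination]
    -- The correction arises because contracting the second index of $U\wedge A$ with $A$ gives
    -- $|A|^2U$.
    refine ⟨c, a - c * acceleration g γ t (accelerationVector g γ t), rfl, ?_, ?_⟩
    · simp [wedge_apply, hU, hA, hF]
    · rw [TwoForm.flip_apply, TwoForm.flip_apply]
      simp only [Submodule.coe_add, Submodule.coe_smul, add_apply,
        smul_apply, wedge_apply, hA']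
      module
  · obtain ⟨σ, μ, ν, ρ⟩ := z
    rintro ⟨c, k, h1, h2, h3⟩
    dsimp only at h1 h2 h3
    set F : TwoForm n := μ - c • wedge (unitCovector g γ t) (acceleration g γ t) with hF
    have hFU : (F : Bilin n) (unitTangent g γ t) = 0 := by
      simp [hF, h2, wedge_apply, hU, hA]
    refine Submodule.mem_sup.2 ⟨_, Submodule.mem_span_triple.2
      ⟨k + c * acceleration g γ t (accelerationVector g γ t), ν, c, rfl⟩, _, ⟨F, hFU, rfl⟩, ?_⟩
    rw [tractor_combination, h1, h3, hF, add_sub_cancel]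
    congr 3
    rw [TwoForm.flip_apply, TwoForm.flip_apply]
    simp only [Submodule.coe_sub, Submodule.coe_smul, sub_apply,
      smul_apply, wedge_apply, hA']
    module

/-- Replaces the existential coefficients by contractions with $U$ and $A$, so that they depend
smoothly on the parameter. -/
theorem IsRegularCurve.eq_of_mem_bundleS (hγ : IsRegularCurve n γ s) {t : ℝ} (ht : t ∈ s)
    {z : Tractor n} (hz : z ∈ bundleS g γ t) :
    z.1 = z.1 (unitTangent g γ t) • unitCovector g γ t ∧
      (z.2.1 : Bilin n) (unitTangent g γ t) = z.1 (unitTangent g γ t) • acceleration g γ t ∧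
      z.2.2.2 = (z.2.2.2 (unitTangent g γ t)
          - (z.2.1 : Bilin n) (unitTangent g γ t) (accelerationVector g γ t)) • unitCovector g γ t
        + z.2.2.1 • acceleration g γ t
        + (z.2.1 : Bilin n).flip (accelerationVector g γ t) := by
  obtain ⟨c, k, h1, h2, h3⟩ := (hγ.mem_bundleS_iff ht z).1 hz
  have hU := hγ.unitCovector_unitTangent (g := g) ht
  have hA := hγ.acceleration_unitTangent (g := g) ht
  have hc : z.1 (unitTangent g γ t) = c := by simp [h1, hU]
  have hk : z.2.2.2 (unitTangent g γ t)
      - (z.2.1 : Bilin n) (unitTangent g γ t) (accelerationVector g γ t) = k := by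
    rw [h3]
    simp [hU, hA]
  rw [hc, hk]
  exact ⟨h1, h2, h3⟩

/-- An element of $\mathcal C$ has $\sigma=0$, which kills the third generator of $\mathcal B$; the
2-form, which determines the element of $\mathcal C$, then vanishes. -/
theorem IsRegularCurve.disjoint_bundleB_bundleC (hγ : IsRegularCurve n γ s) {t : ℝ} (ht : t ∈ s) :
    Disjoint (bundleB g γ t) (bundleC g γ t) := by
  have hU := hγ.unitCovector_unitTangent (g := g) ht
  rw [Submodule.disjoint_def]
  rintro z hz ⟨F, hF, rfl⟩
  obtain ⟨a, b, c, h⟩ := Submodule.mem_span_triple.1 hz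
  rw [← add_zero (_ + c • _), show (0 : Tractor n) = (0, 0, 0, 0) from rfl,
    tractor_combination] at h
  obtain ⟨h1, h2⟩ := Prod.mk.inj h
  have h2 := (Prod.mk.inj h2).1
  have hc : c = 0 := by
    have := congrArg (fun L : Covector n => L (unitTangent g γ t)) h1
    simpa [hU] using this
  rw [hc, zero_smul, zero_add] at h2
  rw [← h2]
  rfl

/-- The $U$-coefficient in $J$ is the one that cancels the tangential part $-|A|^2-\mathrm P(U,U)$
of the other terms. -/
theorem IsRegularCurve.normalisedJerk_unitTangent (hγ : IsRegularCurve n γ s) (P : M → Bilin n)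
    {t : ℝ} (ht : t ∈ s) : normalisedJerk g P γ t (unitTangent g γ t) = 0 := by
  have hU := hγ.unitCovector_unitTangent (g := g) ht
  simp [normalisedJerk, hγ.partialCovector_acceleration_unitTangent ht, hU]

theorem IsPreserved.normalisedJerk_eq_zero (hγ : IsRegularCurve n γ s) {P : M → Bilin n}
    (hP : ∀ x v w, P x v w = P x w v) (h : IsPreserved g P γ s (bundleS g γ)) {t : ℝ}
    (ht : t ∈ s) : normalisedJerk g P γ t = 0 := by
  have hU := hγ.unitCovector_unitTangent (g := g) ht
  have hA := hγ.acceleration_unitTangent (g := g) ht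
  have hA' := hγ.unitCovector_accelerationVector (g := g) ht
  have h0 (x₀ x : M) : covectorInChart x₀ x (0 : Covector n) = 0 := by
    ext; simp [covectorInChart_apply]
  have h0' (x₀ x : M) : bilinInChart x₀ x (0 : Bilin n) = 0 := by ext; simp [bilinInChart_apply]
  have hflip : (P (γ t)).flip (unitTangent g γ t) = P (γ t) (unitTangent g γ t) := by
    ext w
    exact hP _ _ _
  -- The test section is a generator of $\mathcal B$ whose derivative contains $\partial A$ in the
  -- last slot.
  have hS := h (fun r => (0, 0, 1, acceleration g γ r))
    { sigma := fun r _ => by simpa only [h0] using contDiffAt_const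
      mu := fun r _ => by simpa only [Submodule.coe_zero, h0'] using contDiffAt_const
      nu := fun r _ => contDiffAt_const
      rho := fun r hr => hγ.contDiffAt_acceleration hr (mem_extChartAt_source _) }
    (fun r hr => (le_sup_left : bundleB g γ r ≤ bundleS g γ r) (Submodule.subset_span (by simp)))
    t ht
  obtain ⟨c, k, -, -, h3⟩ := (hγ.mem_bundleS_iff ht _).1 hS
  have hT : (partialTwoForm g γ (fun _ => 0) t : TwoForm n) = 0 := by
    apply Subtype.ext
    ext v w
    simp [partialTwoForm, covDerivBilin, h0']
  simp only [tractorDerivative, TwoForm.flip_apply, partialFun, hT] at h3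
  simp only [deriv_const, mul_zero, hA, zero_apply, Submodule.coe_zero, neg_zero, add_zero,
    sub_zero, one_smul, zero_smul, zero_sub, Submodule.coe_add, Submodule.coe_neg,
    add_apply, neg_apply, wedge_apply, hA', smul_zero, neg_neg] at h3
  -- The $\mu$-slot of the derivative is $-U\wedge A$, so `h3` reads $\partial A-\mathrm
  -- P(U)=(k-|A|^2)U$; adding the $U$-term of the jerk gives `k'`.
  set k' : ℝ := k - acceleration g γ t (accelerationVector g γ t)
    + (acceleration g γ t (accelerationVector g γ t)
        + P (γ t) (unitTangent g γ t) (unitTangent g γ t)) with hk'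
  have hJ : normalisedJerk g P γ t = k' • unitCovector g γ t := by
    rw [normalisedJerk, hflip, hk', add_sub_right_comm]
    refine (congrArg (· + _) h3).trans ?_
    module
  have h4 := hγ.normalisedJerk_unitTangent (g := g) P ht
  rw [hJ, smul_apply, hU, smul_eq_mul, mul_one] at h4
  rw [hJ, h4, zero_smul]

theorem isConformalCircle_iff (g : Metric n M) (P : M → Bilin n) (γ : ℝ → M) (s : Set ℝ) :
    IsConformalCircle g P γ s ↔ ∀ t ∈ s, normalisedJerk g P γ t = 0 := by
  refine forall₂_congr fun t _ => ?_
  rw [normalisedJerk, ← sub_eq_zero, sub_sub_eq_add_sub]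

theorem IsRegularCurve.isPreserved_of_normalisedJerk (hγ : IsRegularCurve n γ s) {P : M → Bilin n}
    (hP : ∀ x v w, P x v w = P x w v) (hJ : ∀ t ∈ s, normalisedJerk g P γ t = 0) :
    IsPreserved g P γ s (bundleS g γ) := by
  intro Φ hΦ hmem t ht
  have hx := mem_extChartAt_source (I := 𝓡 n) (γ t)
  have hU := hγ.unitCovector_unitTangent (g := g) ht
  have hA := hγ.acceleration_unitTangent (g := g) ht
  have hA' := hγ.unitCovector_accelerationVector (g := g) ht
  have hflip : (P (γ t)).flip (unitTangent g γ t) = P (γ t) (unitTangent g γ t) := by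
    ext w
    exact hP _ _ _
  have hσ := (hΦ.sigma t ht).differentiableAt (by simp)
  have hμ := (hΦ.mu t ht).differentiableAt (by simp)
  have hν := (hΦ.nu t ht).differentiableAt (by simp)
  have hρ := (hΦ.rho t ht).differentiableAt (by simp)
  have hu := (hγ.contDiffAt_chartUnit (g := g) ht hx).differentiableAt (by simp)
  have hul := hγ.differentiableAt_unitCovector (g := g) ht hx
  have ha := (hγ.contDiffAt_acceleration (g := g) ht hx).differentiableAt (by simp)
  have hav := hγ.differentiableAt_chartAcceleration (g := g) ht hx
  -- The coefficients of the section, computed in the fixed chart at `γ t` so that they are visibly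
  -- differentiable there.
  set c : ℝ → ℝ := fun r =>
    covectorInChart (γ t) (γ r) (Φ r).1 (chartUnit g (γ t) γ r) with hc
  set k : ℝ → ℝ := fun r =>
    covectorInChart (γ t) (γ r) (Φ r).2.2.2 (chartUnit g (γ t) γ r)
      - bilinInChart (γ t) (γ r) (Φ r).2.1 (chartUnit g (γ t) γ r) (chartAcceleration g (γ t) γ r)
    with hk
  have hcd : DifferentiableAt ℝ c t := hσ.clm_apply hu
  have hkd : DifferentiableAt ℝ k t := (hρ.clm_apply hu).sub ((hμ.clm_apply hu).clm_apply hav)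
  -- The defining equations hold on a neighbourhood in one chart, hence can be differentiated; `d1`,
  -- `d2`, `d3` are their derivatives.
  have hev : ∀ᶠ r in 𝓝 t,
      covectorInChart (γ t) (γ r) (Φ r).1
        = c r • covectorInChart (γ t) (γ r) (unitCovector g γ r) ∧
      bilinInChart (γ t) (γ r) (Φ r).2.1 (chartUnit g (γ t) γ r)
        = c r • covectorInChart (γ t) (γ r) (acceleration g γ r) ∧
      covectorInChart (γ t) (γ r) (Φ r).2.2.2
        = k r • covectorInChart (γ t) (γ r) (unitCovector g γ r)
          + (Φ r).2.2.1 • covectorInChart (γ t) (γ r) (acceleration g γ r)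
          + (bilinInChart (γ t) (γ r) (Φ r).2.1).flip (chartAcceleration g (γ t) γ r) := by
    filter_upwards [hγ.eventually ht hx] with r hr
    obtain ⟨h1, h2, h3⟩ := hγ.eq_of_mem_bundleS hr.1 (hmem r hr.1)
    have hu' : fromChart (γ t) (γ r) (chartUnit g (γ t) γ r) = unitTangent g γ r :=
      fromChart_toChart hr.2 _
    have ha' : fromChart (γ t) (γ r) (chartAcceleration g (γ t) γ r) = accelerationVector g γ r :=
      fromChart_toChart hr.2 _
    refine ⟨?_, ?_, ?_⟩
    · ext w
      simp only [hc, covectorInChart_apply, smul_apply, hu']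
      exact congrArg (fun L : Covector n => L _) h1
    · ext w
      simp only [hc, covectorInChart_apply, bilinInChart_apply, smul_apply, hu']
      exact congrArg (fun L : Covector n => L _) h2
    · ext w
      simp only [hk, covectorInChart_apply, bilinInChart_apply, smul_apply, add_apply,
        ContinuousLinearMap.flip_apply, hu', ha']
      exact congrArg (fun L : Covector n => L _) h3
  obtain ⟨e1, e2, e3⟩ := hev.self_of_nhds
  simp only [covectorInChart_self, bilinInChart_self, chartUnit_self, chartAcceleration_self]
    at e1 e2 e3
  have hct : (Φ t).1 (unitTangent g γ t) = c t := by
    simp only [hc, covectorInChart_self, chartUnit_self]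
  have d1 : partialCovector g γ (fun r => (Φ r).1) t =
      ((speed g γ t)⁻¹ * deriv c t) • unitCovector g γ t + c t • acceleration g γ t := by
    have h := covDerivCovector_smul (a := (speed g γ t)⁻¹) (Γ_U := connectionAlong g γ t) hcd hul
    rw [covectorInChart_self, ← e1] at h
    rw [partialCovector, covDerivCovector_congr (hev.mono fun r hr => hr.1), h]
    rfl
  have d2 : (partialTwoForm g γ (fun r => (Φ r).2.1) t : Bilin n) (unitTangent g γ t)
      + ((Φ t).2.1 : Bilin n) (accelerationVector g γ t) =
      ((speed g γ t)⁻¹ * deriv c t) • acceleration g γ t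
        + c t • partialCovector g γ (acceleration g γ) t := by
    have h := covDerivCovector_bilin_apply (a := (speed g γ t)⁻¹) (Γ_U := connectionAlong g γ t)
      hμ hu
    have h' := covDerivCovector_smul (a := (speed g γ t)⁻¹) (Γ_U := connectionAlong g γ t) hcd ha
    rw [covDerivCovector_congr (hev.mono fun r hr => hr.2.1), hγ.covDerivVector_chartUnit ht,
      bilinInChart_self, chartUnit_self, e2] at h
    rw [covectorInChart_self, h] at h'
    exact h'
  set DA : Coord n := covDerivVector (speed g γ t)⁻¹ (connectionAlong g γ t)
    (chartAcceleration g (γ t) γ) t with hDA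
  have d3 : partialCovector g γ (fun r => (Φ r).2.2.2) t =
      ((speed g γ t)⁻¹ * deriv k t) • unitCovector g γ t + k t • acceleration g γ t
      + (partialFun g γ (fun r => (Φ r).2.2.1) t • acceleration g γ t
        + (Φ t).2.2.1 • partialCovector g γ (acceleration g γ) t)
      + ((partialTwoForm g γ (fun r => (Φ r).2.1) t : Bilin n).flip (accelerationVector g γ t)
        + ((Φ t).2.1 : Bilin n).flip DA) := by
    have h1 := covDerivCovector_smul (a := (speed g γ t)⁻¹) (Γ_U := connectionAlong g γ t) hkd hul
    have h2 := covDerivCovector_smul (a := (speed g γ t)⁻¹) (Γ_U := connectionAlong g γ t) hν ha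
    have h3 := covDerivCovector_bilin_apply (a := (speed g γ t)⁻¹) (Γ_U := connectionAlong g γ t)
      (hasDerivAt_flip hμ).differentiableAt hav
    have h4 := covDerivCovector_add (a := (speed g γ t)⁻¹) (Γ_U := connectionAlong g γ t)
      (hkd.smul hul) (hν.smul ha)
    have h5 := covDerivCovector_add (a := (speed g γ t)⁻¹) (Γ_U := connectionAlong g γ t)
      ((hkd.smul hul).add (hν.smul ha))
      ((hasDerivAt_flip hμ).differentiableAt.clm_apply hav)
    rw [covDerivBilin_flip hμ] at h3
    rw [partialCovector, covDerivCovector_congr (hev.mono fun r hr => hr.2.2)]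
    simp only [Pi.add_apply, Pi.smul_apply', covectorInChart_self, bilinInChart_self,
      chartAcceleration_self] at h1 h2 h3 h4 h5
    rw [e3]
    refine h5.trans ?_
    congr 1
    refine h4.trans ?_
    exact congrArg₂ (· + ·) h1 h2
  have hJt : partialCovector g γ (acceleration g γ) t =
      P (γ t) (unitTangent g γ t) - (acceleration g γ t (accelerationVector g γ t)
        + P (γ t) (unitTangent g γ t) (unitTangent g γ t)) • unitCovector g γ t := by
    rw [← hflip]
    exact (isConformalCircle_iff g P γ s).2 hJ t ht
  -- The equation $J=0$ with its index raised, needed because $\mu$ is contracted with $\partial A$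
  -- in `d3`.
  have hDA' : DA = sharp g (γ t) (P (γ t) (unitTangent g γ t))
      - (acceleration g γ t (accelerationVector g γ t)
        + P (γ t) (unitTangent g γ t) (unitTangent g γ t)) • unitTangent g γ t := by
    apply (metricAt_isInvertible g (γ t)).injective
    rw [hDA, hγ.metricAt_covDerivVector_chartAcceleration ht, hJt, map_sub, metricAt_sharp,
      map_smul]
    rfl
  have hρU : (Φ t).2.2.2 (unitTangent g γ t) =
      k t + c t * acceleration g γ t (accelerationVector g γ t) := by
    rw [e3]
    simp [hU, hA, e2]
  have hσA : (Φ t).1 (accelerationVector g γ t) = 0 := by rw [e1, smul_apply, hA', smul_zero]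
  have hσP : (Φ t).1 (sharp g (γ t) (P (γ t) (unitTangent g γ t))) =
      c t * P (γ t) (unitTangent g γ t) (unitTangent g γ t) := by
    rw [e1, smul_apply, unitCovector_apply_eq, smul_eq_mul]
  have d2' := eq_sub_of_add_eq d2
  rw [TwoForm.flip_apply] at e3 d3
  -- The new coefficients are $\partial c-\nu$, read off the $\sigma$-slot, and the total
  -- coefficient of $U$ in the last slot once the new $\mu$ contracted with $A$ is moved across,
  -- which contributes $\rho(A)+c\,\mathrm P(U,A)$.
  refine (hγ.mem_bundleS_iff ht _).2 ⟨(speed g γ t)⁻¹ * deriv c t - (Φ t).2.2.1,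
    (speed g γ t)⁻¹ * deriv k t - (Φ t).2.2.1 * (acceleration g γ t (accelerationVector g γ t)
        + P (γ t) (unitTangent g γ t) (unitTangent g γ t))
      + (Φ t).2.2.2 (accelerationVector g γ t)
      + c t * P (γ t) (unitTangent g γ t) (accelerationVector g γ t), ?_, ?_, ?_⟩
  · simp only [tractorDerivative]
    rw [d1, e2]
    module
  · simp only [tractorDerivative, Submodule.coe_add, Submodule.coe_sub, add_apply, sub_apply,
      wedge_apply]
    rw [d2', hct, hU, hρU, hJt, e3, e1]
    module
  · simp only [tractorDerivative, TwoForm.flip_apply]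
    simp only [Submodule.coe_add, Submodule.coe_sub,
      add_apply, sub_apply, wedge_apply]
    rw [d3, hσP, hρU, hJt, hσA, hA', hDA', TwoForm.flip_apply, map_sub, map_smul, e2, e1]
    module

end Curve

end AdjointTractor

theorem mainTheorem4 {n : ℕ} {M : Type*} [TopologicalSpace M]
    [ChartedSpace (AdjointTractor.Coord n) M] [IsManifold (𝓡 n) ∞ M]
    (g : AdjointTractor.Metric n M) (P : M → AdjointTractor.Bilin n)
    (hP : AdjointTractor.IsRhoTensor g P)
    (γ : ℝ → M) (s : Set ℝ) (hγ : AdjointTractor.IsRegularCurve n γ s) :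
    (∀ t ∈ s, Disjoint (AdjointTractor.bundleB g γ t) (AdjointTractor.bundleC g γ t)) ∧
    (AdjointTractor.IsPreserved g P γ s (AdjointTractor.bundleS g γ) ↔
      ∀ t ∈ s, AdjointTractor.normalisedJerk g P γ t = 0) ∧
    (AdjointTractor.IsPreserved g P γ s (AdjointTractor.bundleS g γ) ↔
      AdjointTractor.IsConformalCircle g P γ s) := by
  have hJ : AdjointTractor.IsPreserved g P γ s (AdjointTractor.bundleS g γ) ↔
      ∀ t ∈ s, AdjointTractor.normalisedJerk g P γ t = 0 :=
    ⟨fun h _ ht => h.normalisedJerk_eq_zero hγ hP.symm ht,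
      hγ.isPreserved_of_normalisedJerk hP.symm⟩
  exact ⟨fun _ ht => hγ.disjoint_bundleB_bundleC ht, hJ,
    hJ.trans (AdjointTractor.isConformalCircle_iff g P γ s).symm⟩
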